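/- **Theorem (PBW basis).** Let $\Bbbk$ be a field, let $n\ge 0$, and let $x_1,\dots,x_n$ be generators with degrees $|x_i|\in\mathbb Z$. Let $$R=\Bbbk\langle x_1,\dots,x_n\rangle\big/\big(x_ix_j-(-1)^{|x_i||x_j|}x_jx_i \;:\; 1\le i,j\le n\big)$$ be the graded commutative polynomial algebra on them. Let $R$ carry an arbitrary differential graded Poisson structure: a $\Bbbk$-bilinear bracket $\{\cdot,\cdot\}$ of degree $0$ and a $\Bbbk$-linear map $d$ of degree $1$ with $d^2=0$ such that, for all homogeneous $a,b,c\in R$, - $\{a,b\}=-(-1)^{|a||b|}\{b,a\}$, - $\{a,\{b,c\}\}=\{\{a,b\},c\}+(-1)^{|a||b|}\{b,\{a,c\}\}$, - $\{a,bc\}=\{a,b\}c+(-1)^{|a||b|}b\{a,c\}$, - $d\{a,b\}=\{d(a),b\}+(-1)^{|a|}\{a,d(b)\}$, - $d(ab)=d(a)b+(-1)^{|a|}a\,d(b)$. If $\operatorname{char}\Bbbk=2$, assume in addition that $\{x_i,x_i\}=0$ for all $i$; if $\operatorname{char}\Bbbk=3$, assume in addition that $\{x_i,\{x_i,x_i\}\}=0$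 for all $i$ with $|x_i|$ odd. (In all other characteristics nothing is added.) For $1\le r\le n$ let $\psi_r:R\to R$ be the $\Bbbk$-linear map determined by $\psi_r(x_i)=\delta_{ri}$ and $\psi_r(ab)=a\psi_r(b)+(-1)^{|a||b|}b\psi_r(a)$ for homogeneous $a,b$. Let $F(R)=R\langle y_1,\dots,y_n\rangle$ be the free product over $\Bbbk$ of $R$ and the free algebra $\Bbbk\langle y_1,\dots,y_n\rangle$, and put $\psi(f)=\sum_{r=1}^n\psi_r(f)\,y_r\in F(R)$ for $f\in R$. The universal enveloping algebra of $R$ is $R^e=F(R)/J$, where $J$ is the two-sided ideal generated by $$y_iy_j-(-1)^{|x_i||x_j|}y_jy_i-\psi(\{x_i,x_j\}),\qquad y_ix_j-(-1)^{|x_i||x_j|}x_jy_i-\{x_i,x_j\}\qquad(1\le i,j\le n).$$ Then the ordered monomials $$x_1^{i_1}x_2^{i_2}\cdots x_n^{i_n}\,y_1^{j_1}y_2^{j_2}\cdots y_n^{j_n},\qquad i_r,j_r\in\{0,1,2,\dots\},$$ with $i_r,j_r\le 1$ for every $r$ such that $|x_r|$ is odd when $\operatorname{char}\Bbbk\ne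 2$, are pairwise distinct and form a $\Bbbk$-linear basis of $R^e$. -/

import Mathlib

/-! # Differential graded Poisson algebras and the enveloping algebra of a
graded commutative polynomial algebra -/

namespace DGP

/-- A DG Poisson structure on a `ℤ`-graded `k`-algebra `A = ⨁ m, 𝒜 m`: a Poisson bracket of degree `0`
and a differential of degree `1`. The Koszul sign `(-1) ^ (p * q)` is an integer power in `k`. -/
structure DGPoisson {k A : Type*} [Field k] [Ring A] [Algebra k A]
    (𝒜 : ℤ → Submodule k A) [GradedAlgebra 𝒜] where
  /-- the Poisson bracket `{a, b}` -/
  bracket : A →ₗ[k] A →ₗ[k] A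
  /-- the differential -/
  d : A →ₗ[k] A
  bracket_mem : ∀ {p q : ℤ} {a b : A}, a ∈ 𝒜 p → b ∈ 𝒜 q → bracket a b ∈ 𝒜 (p + q)
  antisymm : ∀ {p q : ℤ} {a b : A}, a ∈ 𝒜 p → b ∈ 𝒜 q →
    bracket a b = -((-1 : k) ^ (p * q) • bracket b a)
  jacobi : ∀ {p q r : ℤ} {a b c : A}, a ∈ 𝒜 p → b ∈ 𝒜 q → c ∈ 𝒜 r →
    bracket a (bracket b c) =
      bracket (bracket a b) c + (-1 : k) ^ (p * q) • bracket b (bracket a c)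
  graded_comm : ∀ {p q : ℤ} {a b : A}, a ∈ 𝒜 p → b ∈ 𝒜 q →
    a * b = (-1 : k) ^ (p * q) • (b * a)
  bracket_mul : ∀ {p q r : ℤ} {a b c : A}, a ∈ 𝒜 p → b ∈ 𝒜 q → c ∈ 𝒜 r →
    bracket a (b * c) = bracket a b * c + (-1 : k) ^ (p * q) • (b * bracket a c)
  d_mem : ∀ {p : ℤ} {a : A}, a ∈ 𝒜 p → d a ∈ 𝒜 (p + 1)
  d_d : ∀ a : A, d (d a) = 0
  d_bracket : ∀ {p q : ℤ} {a b : A}, a ∈ 𝒜 p → b ∈ 𝒜 q →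
    d (bracket a b) = bracket (d a) b + (-1 : k) ^ p • bracket a (d b)
  d_mul : ∀ {p q : ℤ} {a b : A}, a ∈ 𝒜 p → b ∈ 𝒜 q →
    d (a * b) = d a * b + (-1 : k) ^ p • (a * d b)

section Poly

variable (k : Type*) [Field k] {n : ℕ} (deg : Fin n → ℤ)

/-- The relations `x_i x_j = (-1)^{|x_i||x_j|} x_j x_i` for all `i, j` (including `i = j`). -/
inductive PolyRel : FreeAlgebra k (Fin n) → FreeAlgebra k (Fin n) → Prop
  | comm (i j : Fin n) : PolyRel (FreeAlgebra.ι k i * FreeAlgebra.ι k j)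
      ((-1 : k) ^ (deg i * deg j) • (FreeAlgebra.ι k j * FreeAlgebra.ι k i))

/-- The graded commutative polynomial algebra `R = T(V)/(x_i x_j - (-1)^{|x_i||x_j|} x_j x_i)`, where `V`
has the homogeneous basis `x_0, …, x_{n-1}` with `|x_i| = deg i`. -/
def Poly : Type _ := RingQuot (PolyRel k deg)

instance : Ring (Poly k deg) := inferInstanceAs (Ring (RingQuot (PolyRel k deg)))

instance : Algebra k (Poly k deg) := inferInstanceAs (Algebra k (RingQuot (PolyRel k deg)))

/-- The generator `x_i` of `R`. -/
def Poly.x (i : Fin n) : Poly k deg := RingQuot.mkAlgHom k (PolyRel k deg) (FreeAlgebra.ι k i)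

theorem Poly.x_comm (i j : Fin n) :
    Poly.x k deg i * Poly.x k deg j =
      (-1 : k) ^ (deg i * deg j) • (Poly.x k deg j * Poly.x k deg i) := by
  have h := RingQuot.mkAlgHom_rel k (PolyRel.comm (k := k) (deg := deg) i j)
  rw [map_mul, map_smul, map_mul] at h
  exact h

/-- The universal property of `R`. -/
def Poly.lift {B : Type*} [Ring B] [Algebra k B] (f : Fin n → B)
    (hf : ∀ i j, f i * f j = (-1 : k) ^ (deg i * deg j) • (f j * f i)) : Poly k deg →ₐ[k] B :=
  RingQuot.liftAlgHom k ⟨FreeAlgebra.lift k f, by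
    rintro _ _ ⟨i, j⟩
    simpa using hf i j⟩

@[simp] theorem Poly.lift_x {B : Type*} [Ring B] [Algebra k B] (f : Fin n → B)
    (hf : ∀ i j, f i * f j = (-1 : k) ^ (deg i * deg j) • (f j * f i)) (i : Fin n) :
    Poly.lift k deg f hf (Poly.x k deg i) = f i := by
  refine (RingQuot.liftAlgHom_mkAlgHom_apply k (FreeAlgebra.lift k f) _ _).trans ?_
  simp

theorem Poly.hom_ext {B : Type*} [Ring B] [Algebra k B] {f g : Poly k deg →ₐ[k] B}
    (h : ∀ i, f (Poly.x k deg i) = g (Poly.x k deg i)) : f = g := by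
  apply RingQuot.ringQuot_ext'
  apply FreeAlgebra.hom_ext
  funext i
  exact h i

/-- The homogeneous component of degree `m` of `R`, spanned by the words in the `x_i` of total
degree `m`. -/
def Poly.comp (m : ℤ) : Submodule k (Poly k deg) :=
  Submodule.span k {a | ∃ l : List (Fin n), (l.map deg).sum = m ∧ a = (l.map (Poly.x k deg)).prod}

theorem Poly.word_mem (l : List (Fin n)) :
    (l.map (Poly.x k deg)).prod ∈ Poly.comp k deg (l.map deg).sum :=
  Submodule.subset_span ⟨l, rfl, rfl⟩

theorem Poly.x_mem (i : Fin n) : Poly.x k deg i ∈ Poly.comp k deg (deg i) := by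
  simpa using Poly.word_mem k deg [i]

instance Poly.gradedMonoid : SetLike.GradedMonoid (Poly.comp k deg) where
  one_mem := by simpa using Poly.word_mem k deg []
  mul_mem := by
    intro p q a b ha hb
    have h : a * b ∈ Poly.comp k deg p * Poly.comp k deg q := Submodule.mul_mem_mul ha hb
    refine (?_ : Poly.comp k deg p * Poly.comp k deg q ≤ Poly.comp k deg (p + q)) h
    unfold Poly.comp
    rw [Submodule.span_mul_span]
    apply Submodule.span_mono
    rintro _ ⟨_, ⟨l, hl, rfl⟩, _, ⟨l', hl', rfl⟩, rfl⟩
    exact ⟨l ++ l', by simp [hl, hl'], by simp⟩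

/-- The decomposition map of the grading of `R`. -/
noncomputable def Poly.decomp : Poly k deg →ₐ[k] DirectSum ℤ (fun m => Poly.comp k deg m) :=
  Poly.lift k deg
    (fun i => DirectSum.of (fun m => Poly.comp k deg m) (deg i) ⟨Poly.x k deg i, Poly.x_mem k deg i⟩)
    (by
      intro i j
      rw [DirectSum.of_mul_of, DirectSum.of_mul_of]
      have hs : ∀ (c : k) (m : ℤ) (z : Poly.comp k deg m),
          c • DirectSum.of (fun m => Poly.comp k deg m) m z =
            DirectSum.of (fun m => Poly.comp k deg m) m (c • z) := by
        intro c m z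
        exact ((DirectSum.lof k ℤ (fun m => Poly.comp k deg m) m).map_smul c z).symm
      rw [hs]
      apply DirectSum.of_eq_of_gradedMonoid_eq
      refine Sigma.subtype_ext (add_comm _ _) ?_
      exact Poly.x_comm k deg i j)

theorem Poly.decomp_word (l : List (Fin n)) :
    Poly.decomp k deg (l.map (Poly.x k deg)).prod =
      DirectSum.of (fun m => Poly.comp k deg m) (l.map deg).sum
        ⟨(l.map (Poly.x k deg)).prod, Poly.word_mem k deg l⟩ := by
  induction l with
  | nil =>
    simp only [List.map_nil, List.prod_nil, map_one]
    rfl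
  | cons i l ih =>
    simp only [List.map_cons, List.prod_cons, map_mul, ih]
    rw [Poly.decomp, Poly.lift_x, DirectSum.of_mul_of]
    rfl

noncomputable instance Poly.gradedAlgebra : GradedAlgebra (Poly.comp k deg) :=
  GradedAlgebra.ofAlgHom _ (Poly.decomp k deg)
    (by
      apply Poly.hom_ext
      intro i
      simp [Poly.decomp])
    (by
      rintro m ⟨a, ha⟩
      induction ha using Submodule.span_induction with
      | mem a h =>
        obtain ⟨l, rfl, rfl⟩ := h
        exact Poly.decomp_word k deg l
      | zero =>
        rw [map_zero]
        exact (map_zero (DirectSum.of (fun m => Poly.comp k deg m) m)).symm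
      | add a b ha hb iha ihb =>
        rw [map_add, iha, ihb, ← map_add]
        rfl
      | smul c a ha iha =>
        rw [map_smul, iha]
        exact ((DirectSum.lof k ℤ (fun m => Poly.comp k deg m) m).map_smul c ⟨a, ha⟩).symm)

/-- The algebra map `a ↦ (a, ψ_r(a); 0, σ_r(a))` into `2 × 2` matrices, where `σ_r` is the automorphism
`x_i ↦ (-1)^{|x_i||x_r|} x_i`; its upper right entry is the anti-differential `ψ_r`. -/
def Poly.psiMatrix (r : Fin n) : Poly k deg →ₐ[k] Matrix (Fin 2) (Fin 2) (Poly k deg) :=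
  Poly.lift k deg
    (fun i => !![Poly.x k deg i, if r = i then 1 else 0;
      0, (-1 : k) ^ (deg i * deg r) • Poly.x k deg i])
    (by
      intro i j
      have hsq : ∀ m : ℤ, (-1 : k) ^ m * (-1 : k) ^ m = 1 := fun m => by
        rw [← mul_zpow]; simp
      have h := Poly.x_comm k deg i j
      ext a b
      fin_cases a <;> fin_cases b
      · simp only [Matrix.mul_apply, Fin.sum_univ_two, Matrix.smul_apply]
        simp [h]
      · by_cases hi : r = i
        · by_cases hj : r = j
          · subst hi; subst hj
            simp [Matrix.mul_apply, smul_smul, hsq, add_comm]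
          · subst hi
            simp [Matrix.mul_apply, hj, mul_comm (deg j)]
        · by_cases hj : r = j
          · subst hj
            simp [Matrix.mul_apply, hi, smul_smul, hsq]
          · simp [Matrix.mul_apply, hi, hj]
      · simp [Matrix.mul_apply]
      · simp only [Matrix.mul_apply, Fin.sum_univ_two]
        simp [h, smul_smul]
        congr 1
        ring)

/-- The anti-differential `ψ_r : R → R`: the `k`-linear map with `ψ_r(x_i) = δ_{ri}` and
`ψ_r(ab) = a ψ_r(b) + (-1)^{|a||b|} b ψ_r(a)` for homogeneous `a, b`
(see `Poly.psi_x` and `Poly.psi_mul`). -/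
def Poly.psi (r : Fin n) : Poly k deg →ₗ[k] Poly k deg where
  toFun a := Poly.psiMatrix k deg r a 0 1
  map_add' a b := by simp
  map_smul' c a := by simp

theorem Poly.psi_x (r i : Fin n) : Poly.psi k deg r (Poly.x k deg i) = if r = i then 1 else 0 := by
  simp [Poly.psi, Poly.psiMatrix]

theorem Poly.graded_comm {p q : ℤ} {a b : Poly k deg} (ha : a ∈ Poly.comp k deg p)
    (hb : b ∈ Poly.comp k deg q) : a * b = (-1 : k) ^ (p * q) • (b * a) := by
  have hx : ∀ (i : Fin n) (l : List (Fin n)),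
      Poly.x k deg i * (l.map (Poly.x k deg)).prod =
        (-1 : k) ^ (deg i * (l.map deg).sum) • ((l.map (Poly.x k deg)).prod * Poly.x k deg i) := by
    intro i l
    induction l with
    | nil => simp
    | cons j l ih =>
      simp only [List.map_cons, List.prod_cons, List.sum_cons]
      rw [← mul_assoc, Poly.x_comm, smul_mul_assoc, mul_assoc, ih, mul_smul_comm, smul_smul,
        ← zpow_add₀ (by simp), ← mul_assoc, mul_add]
  have hw : ∀ l l' : List (Fin n),
      (l.map (Poly.x k deg)).prod * (l'.map (Poly.x k deg)).prod =
        (-1 : k) ^ ((l.map deg).sum * (l'.map deg).sum) •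
          ((l'.map (Poly.x k deg)).prod * (l.map (Poly.x k deg)).prod) := by
    intro l l'
    induction l with
    | nil => simp
    | cons j l ih =>
      simp only [List.map_cons, List.prod_cons, List.sum_cons]
      rw [mul_assoc, ih, mul_smul_comm, ← mul_assoc, hx, smul_mul_assoc, smul_smul,
        ← zpow_add₀ (by simp), mul_assoc]
      congr 2
      ring
  induction ha, hb using Submodule.span_induction₂ with
  | mem_mem a b ha hb =>
    obtain ⟨l, rfl, rfl⟩ := ha
    obtain ⟨l', rfl, rfl⟩ := hb
    exact hw l l'
  | zero_left => simp
  | zero_right => simp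
  | add_left a a' b _ _ _ h h' => rw [add_mul, h, h', mul_add, smul_add]
  | add_right a b b' _ _ _ h h' => rw [mul_add, h, h', add_mul, smul_add]
  | smul_left c a b _ _ h => rw [smul_mul_assoc, h, mul_smul_comm, smul_comm]
  | smul_right c a b _ _ h => rw [mul_smul_comm, h, smul_mul_assoc, smul_comm]

theorem Poly.psiMatrix_of_mem (r : Fin n) {p : ℤ} {a : Poly k deg} (ha : a ∈ Poly.comp k deg p) :
    Poly.psiMatrix k deg r a 0 0 = a ∧ Poly.psiMatrix k deg r a 1 0 = 0 ∧
      Poly.psiMatrix k deg r a 1 1 = (-1 : k) ^ (p * deg r) • a ∧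
      Poly.psiMatrix k deg r a 0 1 ∈ Poly.comp k deg (p - deg r) := by
  induction ha using Submodule.span_induction with
  | mem a h =>
    obtain ⟨l, rfl, rfl⟩ := h
    induction l with
    | nil => simp
    | cons j l ih =>
      obtain ⟨h1, h2, h3, h4⟩ := ih
      have hj : Poly.psiMatrix k deg r (Poly.x k deg j) =
          !![Poly.x k deg j, if r = j then 1 else 0;
            0, (-1 : k) ^ (deg j * deg r) • Poly.x k deg j] := by simp [Poly.psiMatrix]
      simp only [List.map_cons, List.prod_cons, List.sum_cons, map_mul, Matrix.mul_apply,
        Fin.sum_univ_two, h1, h2, h3, hj]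
      refine ⟨by simp, by simp, ?_, ?_⟩
      · simp [smul_smul, ← zpow_add₀, add_mul, add_comm]
      · apply Submodule.add_mem
        · have := SetLike.mul_mem_graded (Poly.x_mem k deg j) h4
          simpa [add_sub_assoc] using this
        · by_cases h : r = j
          · subst h
            simpa using Submodule.smul_mem _ _ (Poly.word_mem k deg l)
          · simp [h]
  | zero => simp
  | add a b _ _ iha ihb =>
    obtain ⟨h1, h2, h3, h4⟩ := iha
    obtain ⟨g1, g2, g3, g4⟩ := ihb
    simp only [map_add, Matrix.add_apply]
    exact ⟨by rw [h1, g1], by rw [h2, g2, add_zero], by rw [h3, g3, smul_add],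
      Submodule.add_mem _ h4 g4⟩
  | smul c a _ iha =>
    obtain ⟨h1, h2, h3, h4⟩ := iha
    simp only [map_smul, Matrix.smul_apply]
    exact ⟨by rw [h1], by rw [h2, smul_zero], by rw [h3, smul_comm], Submodule.smul_mem _ _ h4⟩

theorem Poly.psi_mul (r : Fin n) {p q : ℤ} {a b : Poly k deg} (ha : a ∈ Poly.comp k deg p)
    (hb : b ∈ Poly.comp k deg q) : Poly.psi k deg r (a * b) =
      a * Poly.psi k deg r b + (-1 : k) ^ (p * q) • (b * Poly.psi k deg r a) := by
  obtain ⟨h1, -, -, h4⟩ := Poly.psiMatrix_of_mem k deg r ha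
  obtain ⟨-, -, g3, -⟩ := Poly.psiMatrix_of_mem k deg r hb
  change Poly.psiMatrix k deg r (a * b) 0 1 = a * Poly.psiMatrix k deg r b 0 1 +
    (-1 : k) ^ (p * q) • (b * Poly.psiMatrix k deg r a 0 1)
  rw [map_mul, Matrix.mul_apply, Fin.sum_univ_two, h1, g3, mul_smul_comm,
    Poly.graded_comm k deg h4 hb, smul_smul, ← zpow_add₀ (by simp)]
  congr 3
  ring

end Poly

section Env

variable (k : Type*) [Field k] {n : ℕ} (deg : Fin n → ℤ)

/-- The relations of `R` inside the free algebra on `x_i = inl i` and `y_i = inr i`. -/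
inductive FreeRel : FreeAlgebra k (Fin n ⊕ Fin n) → FreeAlgebra k (Fin n ⊕ Fin n) → Prop
  | comm (i j : Fin n) : FreeRel
      (FreeAlgebra.ι k (Sum.inl i) * FreeAlgebra.ι k (Sum.inl j))
      ((-1 : k) ^ (deg i * deg j) • (FreeAlgebra.ι k (Sum.inl j) * FreeAlgebra.ι k (Sum.inl i)))

/-- `F(R) = R⟨y_0, …, y_{n-1}⟩`, the free `R`-ring on the `y_i`, that is, the free product of the
`k`-algebras `R` and `k⟨y_0, …, y_{n-1}⟩`. -/
def FreePoly : Type _ := RingQuot (FreeRel k deg)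

instance : Ring (FreePoly k deg) := inferInstanceAs (Ring (RingQuot (FreeRel k deg)))

instance : Algebra k (FreePoly k deg) := inferInstanceAs (Algebra k (RingQuot (FreeRel k deg)))

/-- The generator `y_i` of `F(R)`. -/
def FreePoly.y (i : Fin n) : FreePoly k deg :=
  RingQuot.mkAlgHom k (FreeRel k deg) (FreeAlgebra.ι k (Sum.inr i))

/-- The canonical map `R → F(R)`. -/
def FreePoly.incl : Poly k deg →ₐ[k] FreePoly k deg :=
  Poly.lift k deg
    (fun i => (RingQuot.mkAlgHom k (FreeRel k deg) (FreeAlgebra.ι k (Sum.inl i)) : FreePoly k deg))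
    (by
      intro i j
      have h := RingQuot.mkAlgHom_rel k (FreeRel.comm (k := k) (deg := deg) i j)
      rw [map_mul, map_smul, map_mul] at h
      exact h)

/-- `ψ : R → F(R)`, `ψ(f) = ∑ r, ψ_r(f) y_r`. -/
def FreePoly.psi (f : Poly k deg) : FreePoly k deg :=
  ∑ r : Fin n, FreePoly.incl k deg (Poly.psi k deg r f) * FreePoly.y k deg r

variable {k deg}

/-- The defining relations of `R^e` on `F(R)`. -/
inductive EnvRel (P : DGPoisson (Poly.comp k deg)) : FreePoly k deg → FreePoly k deg → Prop
  | yy (i j : Fin n) : EnvRel P (FreePoly.y k deg i * FreePoly.y k deg j)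
      ((-1 : k) ^ (deg i * deg j) • (FreePoly.y k deg j * FreePoly.y k deg i) +
        FreePoly.psi k deg (P.bracket (Poly.x k deg i) (Poly.x k deg j)))
  | yx (i j : Fin n) : EnvRel P (FreePoly.y k deg i * FreePoly.incl k deg (Poly.x k deg j))
      ((-1 : k) ^ (deg i * deg j) • (FreePoly.incl k deg (Poly.x k deg j) * FreePoly.y k deg i) +
        FreePoly.incl k deg (P.bracket (Poly.x k deg i) (Poly.x k deg j)))

/-- The universal enveloping algebra `R^e = F(R)/J` of the DG Poisson algebra `R`, where `J` is the
two-sided ideal generated by `y_i y_j - (-1)^{|x_i||x_j|} y_j y_i - ψ({x_i, x_j})` and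
`y_i x_j - (-1)^{|x_i||x_j|} x_j y_i - {x_i, x_j}` for all `i, j`. -/
def Env (P : DGPoisson (Poly.comp k deg)) : Type _ := RingQuot (EnvRel P)

instance (P : DGPoisson (Poly.comp k deg)) : Ring (Env P) :=
  inferInstanceAs (Ring (RingQuot (EnvRel P)))

instance (P : DGPoisson (Poly.comp k deg)) : Algebra k (Env P) :=
  inferInstanceAs (Algebra k (RingQuot (EnvRel P)))

/-- The projection `F(R) → R^e`. -/
def Env.proj (P : DGPoisson (Poly.comp k deg)) : FreePoly k deg →ₐ[k] Env P :=
  RingQuot.mkAlgHom k (EnvRel P)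

/-- The image of `x_i` in `R^e`. -/
def Env.x (P : DGPoisson (Poly.comp k deg)) (i : Fin n) : Env P :=
  Env.proj P (FreePoly.incl k deg (Poly.x k deg i))

/-- The image of `y_i` in `R^e`. -/
def Env.y (P : DGPoisson (Poly.comp k deg)) (i : Fin n) : Env P :=
  Env.proj P (FreePoly.y k deg i)

variable (k deg)

/-- The exponent vectors of the PBW monomials. A generator `x_r` of odd degree satisfies `2 x_r^2 = 0`,
so unless `2 = 0` in `k` the exponents of `x_r` and `y_r` are then at most `1`; otherwise they are
arbitrary. -/
def PBWExponent : Type :=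
  {e : (Fin n → ℕ) × (Fin n → ℕ) //
    ∀ r, Odd (deg r) → (2 : k) ≠ 0 → e.1 r ≤ 1 ∧ e.2 r ≤ 1}

variable {k deg}

/-- The ordered monomial `x_0^{i_0} ⋯ x_{n-1}^{i_{n-1}} y_0^{j_0} ⋯ y_{n-1}^{j_{n-1}}` in `R^e`. -/
def Env.monomial (P : DGPoisson (Poly.comp k deg)) (i j : Fin n → ℕ) : Env P :=
  (List.ofFn fun r => Env.x P r ^ i r).prod * (List.ofFn fun r => Env.y P r ^ j r).prod

end Env

end DGP

/-! ## Skew extensions with PBW basis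

`SkewData` packages the structure constants of an algebra generated by a ring `R` and elements `y_i`
subject to `y_i a = σ_i(a) y_i + δ_i(a)` and `y_i y_j = s_ij y_j y_i + ∑ r, c_ijr y_r`, together with
the consistency conditions on them. -/

/-! In `R^e` one has `y_i a = σ_i(a) y_i + {x_i, a}`, where `σ_i` is the Koszul sign automorphism,
and `y_i y_j = ± y_j y_i + ∑ r, ψ_r({x_i, x_j}) y_r`. Rewriting with these rules shows that the
ordered monomials in the `y_i` span `R^e` over `R`. Independence is the Birkhoff-Witt argument: on
the free `R`-module on ordered words, operators `Y_i` are defined by the rewriting rules, and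
`SkewData.commAt` proves by induction on word length that they satisfy the relations, the Jacobi
identity resolving the overlaps `y_i y_j y_l`. So `R^e` acts on this module, and acting on the empty
word inverts the evaluation `a ⊗ K ↦ a y^K` (`eval_injective`, `eval_surjective`).

The hypotheses of `SkewData` come from the Poisson axioms through `bracket_eq_sum`, `{f, a} = ∑ r,
ψ_r(f) {x_r, a}`, and `psi_bracket`, which turns the Jacobi identity in `R` into one for structure
constants. The overlaps `y_i y_i` and `y_i y_i y_i` also need `{x_i, x_i} = 0` for sign `1` and
`{x_i, {x_i, x_i}} = 0` for sign `-1`; antisymmetry and Jacobi give these only up to the factors 2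
and 3, whence the assumptions in characteristics 2 and 3.

The same theorem, over `k` with zero derivations and constants, gives the monomial basis of `R`; the
two bases multiply to the PBW basis. -/

/-- Structure constants of a skew extension of `R` by generators indexed by `Fin n`. -/
structure SkewData (k R : Type*) [Field k] [Ring R] [Algebra k R] (n : ℕ) where
  /-- the commutation signs -/
  s : Fin n → Fin n → k
  /-- the twisting endomorphisms -/
  σ : Fin n → R →ₐ[k] R
  /-- the skew derivations -/
  δ : Fin n → R →ₗ[k] R
  /-- the structure constants of the bracket of two generators -/
  c : Fin n → Fin n → Fin n → R
  s_symm : ∀ i j, s j i = s i j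
  s_sign : ∀ i j, s i j = 1 ∨ s i j = -1
  σ_comm : ∀ i j a, σ i (σ j a) = σ j (σ i a)
  δ_mul : ∀ i a b, δ i (a * b) = δ i a * b + σ i a * δ i b
  δ_σ : ∀ i j a, δ i (σ j a) = s i j • σ j (δ i a)
  δ_δ : ∀ i j a, δ i (δ j a) = s i j • δ j (δ i a) + ∑ r, c i j r * δ r a
  σ_σ_mul_c : ∀ i j r a, σ i (σ j a) * c i j r = c i j r * σ r a
  σ_c : ∀ i j l r, s i r • σ i (c j l r) = (s i j * s i l) • c j l r
  c_antisymm : ∀ i j r, c i j r = -(s i j • c j i r)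
  -- Antisymmetry alone gives only `2 c_iir = 0`.
  c_self : ∀ i r, s i i = 1 → c i i r = 0
  -- This is the coefficient of `y_t`: moving `y_i` past `∑ r, c_jlr y_r` leaves `δ_i(c_jlt) + ∑ r,
  -- σ_i(c_jlr) c_irt`.
  jacobi : ∀ i j l t,
    (δ i (c j l t) + ∑ r, σ i (c j l r) * c i r t)
      - s i j • (δ j (c i l t) + ∑ r, σ j (c i l r) * c j r t)
      + (s i l * s j l) • (δ l (c i j t) + ∑ r, σ l (c i j r) * c l r t) = 0
  -- For `s_ii = -1` the previous identity at `i = j = l` gives only three times this one.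
  jacobi_self : ∀ i t, s i i ≠ 1 → δ i (c i i t) + ∑ r, σ i (c i i r) * c i r t = 0

/-! ### Admissible words and skew operators on the free module they span. -/

namespace SkewData

open Finsupp

variable {k R : Type*} [Field k] [Ring R] [Algebra k R] {n : ℕ} (D : SkewData k R n)

theorem δ_one (i : Fin n) : D.δ i 1 = 0 := by
  simpa using D.δ_mul i 1 1

/-- `i` may stand immediately before `j` in an admissible word. -/
def rel (i j : Fin n) : Prop := i < j ∨ (i = j ∧ D.s i i = 1)

variable {D} in
theorem rel.trans {i j l : Fin n} (h : D.rel i j) (h' : D.rel j l) : D.rel i l := by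
  rcases h with h | ⟨rfl, h⟩
  · rcases h' with h' | ⟨rfl, -⟩
    exacts [Or.inl (h.trans h'), Or.inl h]
  · exact h'

theorem not_rel {i j : Fin n} (h : ¬ D.rel i j) : j < i ∨ (i = j ∧ D.s i i ≠ 1) := by
  simp only [rel, not_or, not_and, not_lt] at h
  rcases h.1.lt_or_eq with h' | rfl
  exacts [Or.inl h', Or.inr ⟨rfl, h.2 rfl⟩]

/-- The admissible words, which index the basis of the extension over `R`. -/
def Adm : Type := {K : List (Fin n) // K.Pairwise D.rel}

variable {D}

/-- `i` may be prepended to `K`. -/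
def Adm.Fits (i : Fin n) (K : D.Adm) : Prop := ∀ b ∈ K.1, D.rel i b

/-- Prepend a letter. -/
def Adm.cons (i : Fin n) (K : D.Adm) (h : K.Fits i) : D.Adm :=
  ⟨i :: K.1, List.pairwise_cons.2 ⟨h, K.2⟩⟩

/-- The empty word. -/
def Adm.nil : D.Adm := ⟨[], List.Pairwise.nil⟩

/-- The length of an admissible word. -/
def Adm.length (K : D.Adm) : ℕ := K.1.length

@[simp] theorem Adm.length_cons (i : Fin n) (K : D.Adm) (h : K.Fits i) :
    (Adm.cons i K h).length = K.length + 1 := by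
  simp [Adm.length, Adm.cons]

theorem Adm.fits_nil (i : Fin n) : (Adm.nil : D.Adm).Fits i := fun b hb => by
  simp [Adm.nil] at hb

theorem Adm.eq_nil_or_cons (K : D.Adm) : K = Adm.nil ∨ ∃ l J h, K = Adm.cons l J h := by
  obtain ⟨K, hK⟩ := K
  cases K with
  | nil => exact Or.inl rfl
  | cons l J =>
    have h := List.pairwise_cons.1 hK
    exact Or.inr ⟨l, ⟨J, h.2⟩, h.1, rfl⟩

theorem Adm.Fits.cons {i l : Fin n} {K : D.Adm} (h : K.Fits l) (hi : D.rel i l) :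
    (Adm.cons l K h).Fits i := by
  intro b hb
  rcases List.mem_cons.1 hb with rfl | hb
  exacts [hi, hi.trans (h b hb)]

theorem Adm.rel_of_fits_cons {i l : Fin n} {K : D.Adm} {h : K.Fits l}
    (hi : (Adm.cons l K h).Fits i) : D.rel i l :=
  hi l List.mem_cons_self

variable (D)

/-- The free left `R`-module on the admissible words. -/
abbrev Mod : Type _ := D.Adm →₀ R

/-- The basis vector of an admissible word. -/
noncomputable def e (K : D.Adm) : D.Mod := single K 1

variable {D} in
/-- A `k`-linear operator obeying the skew Leibniz rule of the generator `y_i`. -/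
def IsSkew (i : Fin n) (T : D.Mod →ₗ[k] D.Mod) : Prop :=
  ∀ (a : R) (m : D.Mod), T (a • m) = D.σ i a • T m + D.δ i a • m

variable {D} in
theorem IsSkew.eqOn_span {i : Fin n} {T T' : D.Mod →ₗ[k] D.Mod} (hT : IsSkew i T)
    (hT' : IsSkew i T') {S : Set D.Mod} (h : ∀ m ∈ S, T m = T' m) :
    ∀ m ∈ Submodule.span R S, T m = T' m := by
  intro m hm
  induction hm using Submodule.span_induction with
  | mem m hm => exact h m hm
  | zero => simp
  | add m m' _ _ h h' => rw [map_add, map_add, h, h']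
  | smul a m _ h => rw [hT, hT', h]

variable {D} in
-- `T` is not `R`-linear: the Leibniz rule also produces `δ_i(a) m`, so the generators themselves
-- must lie in `N` along with their images.
theorem IsSkew.mem_of_mem_span {i : Fin n} {T : D.Mod →ₗ[k] D.Mod} (hT : IsSkew i T)
    {S : Set D.Mod} {N : Submodule R D.Mod} (h : ∀ m ∈ S, m ∈ N ∧ T m ∈ N) :
    ∀ m ∈ Submodule.span R S, T m ∈ N := by
  intro m hm
  have hN : Submodule.span R S ≤ N := Submodule.span_le.2 fun m hm => (h m hm).1
  induction hm using Submodule.span_induction with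
  | mem m hm => exact (h m hm).2
  | zero => simp
  | add m m' _ _ h h' => rw [map_add]; exact N.add_mem h h'
  | smul a m hm h => rw [hT]; exact N.add_mem (N.smul_mem _ h) (N.smul_mem _ (hN hm))

/-- The skew operator with prescribed values on the basis. -/
noncomputable def skewExt (i : Fin n) (f : D.Adm → D.Mod) : D.Mod →ₗ[k] D.Mod :=
  Finsupp.lsum k fun K =>
    ((LinearMap.toSpanSingleton R D.Mod (f K)).restrictScalars k) ∘ₗ (D.σ i).toLinearMap +
      (Finsupp.lsingle K) ∘ₗ D.δ i

theorem skewExt_single (i : Fin n) (f : D.Adm → D.Mod) (K : D.Adm) (a : R) :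
    D.skewExt i f (single K a) = D.σ i a • f K + single K (D.δ i a) := by
  simp [skewExt]

@[simp] theorem skewExt_e (i : Fin n) (f : D.Adm → D.Mod) (K : D.Adm) :
    D.skewExt i f (D.e K) = f K := by
  simp [e, skewExt_single, δ_one]

theorem isSkew_skewExt (i : Fin n) (f : D.Adm → D.Mod) : IsSkew i (D.skewExt i f) := by
  intro a m
  induction m using Finsupp.induction_linear with
  | zero => simp
  | add m m' h h' => simp only [smul_add, map_add, h, h']; abel
  | single K b =>
    rw [Finsupp.smul_single, skewExt_single, skewExt_single, smul_eq_mul, map_mul, D.δ_mul,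
      smul_add, smul_smul, Finsupp.smul_single, Finsupp.smul_single, single_add, smul_eq_mul,
      smul_eq_mul]
    abel

/-! ### The action of the generators, defined by rewriting. -/

open Classical in
/-- The action of `y_i`, computed with `d` rewriting steps. -/
noncomputable def act : ℕ → Fin n → D.Mod →ₗ[k] D.Mod
  -- The index is fuel: the rule for `y_i y_l J` applies `y_l` to `y_i J`, which need not be made of
  -- shorter words. The value 0 is a default; a word of length 0 fits every letter.
  | 0, i => D.skewExt i fun K => if h : K.Fits i then D.e (Adm.cons i K h) else 0
  | d + 1, i => D.skewExt i fun K =>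
      if h : K.Fits i then D.e (Adm.cons i K h) else
        match K with
        | ⟨[], _⟩ => 0
        | ⟨l :: J, hJ⟩ =>
          if i = l then
            -- A word starting with `i` that does not fit `i` forces `s_ii = -1 ≠ 1`, so 2 is
            -- invertible and the relation reads `2 y_i² = ∑ r, c_iir y_r`.
            (2⁻¹ : k) • ∑ r, D.c i i r • act d r (D.e ⟨J, (List.pairwise_cons.1 hJ).2⟩)
          else
            D.s i l • act d l (act d i (D.e ⟨J, (List.pairwise_cons.1 hJ).2⟩)) +
              ∑ r, D.c i l r • act d r (D.e ⟨J, (List.pairwise_cons.1 hJ).2⟩)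

theorem isSkew_act (d : ℕ) (i : Fin n) : IsSkew i (D.act d i) := by
  cases d <;> exact D.isSkew_skewExt i _

theorem act_of_fits (d : ℕ) (i : Fin n) (K : D.Adm) (h : K.Fits i) :
    D.act d i (D.e K) = D.e (Adm.cons i K h) := by
  cases d <;> simp [act, h]

theorem act_succ_self (d : ℕ) (i : Fin n) (J : D.Adm) (h : J.Fits i) (hs : D.s i i ≠ 1) :
    D.act (d + 1) i (D.e (Adm.cons i J h)) = (2⁻¹ : k) • ∑ r, D.c i i r • D.act d r (D.e J) := by
  have hn : ¬ (Adm.cons i J h).Fits i := fun hf => by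
    rcases Adm.rel_of_fits_cons hf with h | h
    exacts [lt_irrefl _ h, hs h.2]
  rw [act, skewExt_e, dif_neg hn]
  simp only [Adm.cons, if_true]
  rfl

theorem act_succ_of_lt (d : ℕ) {i l : Fin n} (J : D.Adm) (h : J.Fits l) (hl : l < i) :
    D.act (d + 1) i (D.e (Adm.cons l J h)) =
      D.s i l • D.act d l (D.act d i (D.e J)) + ∑ r, D.c i l r • D.act d r (D.e J) := by
  have hn : ¬ (Adm.cons l J h).Fits i := fun hf => by
    rcases Adm.rel_of_fits_cons hf with h | h
    exacts [lt_asymm h hl, hl.ne' h.1]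
  rw [act, skewExt_e, dif_neg hn]
  simp only [Adm.cons, hl.ne', if_false]
  rfl

/-- The span of the words of length at most `d`. -/
noncomputable def fil (d : ℕ) : Submodule R D.Mod :=
  Submodule.span R {m | ∃ K : D.Adm, m = D.e K ∧ K.length ≤ d}

/-- The span of the words of length at most `d`, and of those of length `d + 1` that fit `l`. -/
noncomputable def low (l : Fin n) (d : ℕ) : Submodule R D.Mod :=
  Submodule.span R {m | ∃ K : D.Adm, m = D.e K ∧ (K.length ≤ d ∨ (K.length ≤ d + 1 ∧ K.Fits l))}

theorem e_mem_fil {K : D.Adm} {d : ℕ} (h : K.length ≤ d) : D.e K ∈ D.fil d :=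
  Submodule.subset_span ⟨K, rfl, h⟩

theorem e_mem_low {l : Fin n} {K : D.Adm} {d : ℕ} (h : K.length ≤ d + 1) (h' : K.Fits l) :
    D.e K ∈ D.low l d :=
  Submodule.subset_span ⟨K, rfl, Or.inr ⟨h, h'⟩⟩

theorem fil_le_low (l : Fin n) (d : ℕ) : D.fil d ≤ D.low l d :=
  Submodule.span_mono fun _ ⟨K, hm, h⟩ => ⟨K, hm, Or.inl h⟩

theorem fil_mono {d d' : ℕ} (h : d ≤ d') : D.fil d ≤ D.fil d' :=
  Submodule.span_mono fun _ ⟨K, hm, h'⟩ => ⟨K, hm, h'.trans h⟩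

theorem exists_mem_fil (m : D.Mod) : ∃ d, m ∈ D.fil d := by
  induction m using Finsupp.induction_linear with
  | zero => exact ⟨0, Submodule.zero_mem _⟩
  | add m m' h h' =>
    obtain ⟨d, h⟩ := h
    obtain ⟨d', h'⟩ := h'
    exact ⟨max d d', Submodule.add_mem _ (D.fil_mono (le_max_left _ _) h)
      (D.fil_mono (le_max_right _ _) h')⟩
  | single K a =>
    refine ⟨K.length, ?_⟩
    have : single K a = a • D.e K := by simp [e]
    rw [this]
    exact Submodule.smul_mem _ _ (D.e_mem_fil le_rfl)

theorem k_smul_mem {N : Submodule R D.Mod} (t : k) {m : D.Mod} (h : m ∈ N) : t • m ∈ N := by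
  rw [← algebraMap_smul R t m]
  exact N.smul_mem _ h

/-- The second claim makes the recursion work. In `y_i y_l J = ± y_l y_i J + …` the words of `y_i J`
longer than `J` still fit `l`, so `y_l` merely prepends to them, and no fuel is needed for words the
induction hypothesis does not reach. -/
theorem act_mem (d : ℕ) : ∀ (K : D.Adm), K.length ≤ d → ∀ i : Fin n,
    D.act d i (D.e K) ∈ D.fil (K.length + 1) ∧
      ∀ l, l < i → K.Fits l → D.act d i (D.e K) ∈ D.low l K.length := by
  induction d with
  | zero =>
    intro K hK i
    obtain rfl | ⟨l, J, h, rfl⟩ := K.eq_nil_or_cons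
    · rw [D.act_of_fits _ _ _ (Adm.fits_nil i)]
      exact ⟨D.e_mem_fil (by simp), fun l hl _ =>
        D.e_mem_low (by simp) (Adm.Fits.cons _ (Or.inl hl))⟩
    · simp at hK
  | succ d ih =>
    intro K hK i
    by_cases hf : K.Fits i
    · rw [D.act_of_fits _ _ _ hf]
      exact ⟨D.e_mem_fil (by simp), fun l hl _ =>
        D.e_mem_low (by simp) (Adm.Fits.cons _ (Or.inl hl))⟩
    obtain rfl | ⟨l, J, h, rfl⟩ := K.eq_nil_or_cons
    · exact absurd (Adm.fits_nil i) hf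
    have hJ : J.length ≤ d := by simpa using hK
    have hr : ¬ D.rel i l := fun h' => hf (h.cons h')
    have hsum : ∀ c : Fin n → R, ∑ r, c r • D.act d r (D.e J) ∈ D.fil (Adm.cons l J h).length :=
      fun c => Submodule.sum_mem _ fun r _ => Submodule.smul_mem _ _ (by
        simpa using (ih J hJ r).1)
    rcases D.not_rel hr with hl | ⟨rfl, hs⟩
    · rw [D.act_succ_of_lt d J h hl]
      have key : ∀ N : Submodule R D.Mod, D.fil (Adm.cons l J h).length ≤ N →
          (∀ K' : D.Adm, ∀ hK' : K'.Fits l, K'.length ≤ J.length + 1 →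
            D.e (Adm.cons l K' hK') ∈ N) →
          D.s i l • D.act d l (D.act d i (D.e J)) + ∑ r, D.c i l r • D.act d r (D.e J) ∈ N := by
        intro N hN hN'
        refine N.add_mem (D.k_smul_mem _ ?_) (hN (hsum _))
        refine (D.isSkew_act d l).mem_of_mem_span ?_ _ ((ih J hJ i).2 l hl h)
        rintro _ ⟨K', rfl, hK' | ⟨hK', hf'⟩⟩
        · refine ⟨hN (D.e_mem_fil (by simp; omega)), hN ?_⟩
          exact D.fil_mono (by simpa using hK') (ih K' (hK'.trans hJ) l).1
        · rw [D.act_of_fits _ _ _ hf']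
          exact ⟨hN (D.e_mem_fil (by simpa using hK')), hN' K' hf' hK'⟩
      refine ⟨key _ (D.fil_mono (Nat.le_succ _)) fun K' hf' hK' => D.e_mem_fil (by simpa using hK'),
        fun l' _ hl' => key _ (D.fil_le_low _ _) fun K' hf' hK' =>
          D.e_mem_low (by simpa using hK') (hf'.cons (Adm.rel_of_fits_cons hl'))⟩
    · rw [D.act_succ_self d i J h hs]
      have := D.k_smul_mem (2⁻¹ : k) (hsum (D.c i i))
      exact ⟨D.fil_mono (Nat.le_succ _) this, fun _ _ _ => D.fil_le_low _ _ this⟩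

/-- Independence of the fuel once it reaches the length of the word. The full-length words of `y_i
J` fit `l` by `act_mem`, and on fitting words every amount of fuel prepends the letter. -/
theorem act_succ_eq (d : ℕ) : ∀ (K : D.Adm), K.length ≤ d → ∀ i : Fin n,
    D.act (d + 1) i (D.e K) = D.act d i (D.e K) := by
  induction d with
  | zero =>
    intro K hK i
    obtain rfl | ⟨l, J, h, rfl⟩ := K.eq_nil_or_cons
    · rw [D.act_of_fits _ _ _ (Adm.fits_nil i), D.act_of_fits _ _ _ (Adm.fits_nil i)]
    · simp at hK
  | succ d ih =>
    intro K hK i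
    by_cases hf : K.Fits i
    · rw [D.act_of_fits _ _ _ hf, D.act_of_fits _ _ _ hf]
    obtain rfl | ⟨l, J, h, rfl⟩ := K.eq_nil_or_cons
    · exact absurd (Adm.fits_nil i) hf
    have hJ : J.length ≤ d := by simpa using hK
    have hr : ¬ D.rel i l := fun h' => hf (h.cons h')
    rcases D.not_rel hr with hl | ⟨rfl, hs⟩
    · rw [D.act_succ_of_lt _ J h hl, D.act_succ_of_lt _ J h hl]
      simp only [ih J hJ]
      congr 2
      refine (D.isSkew_act _ l).eqOn_span (D.isSkew_act _ l) ?_ _ ((D.act_mem d J hJ i).2 l hl h)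
      rintro _ ⟨K', rfl, hK' | ⟨hK', hf'⟩⟩
      · exact ih K' (hK'.trans hJ) l
      · rw [D.act_of_fits _ _ _ hf', D.act_of_fits _ _ _ hf']
    · rw [D.act_succ_self _ i J h hs, D.act_succ_self _ i J h hs]
      simp only [ih J hJ]

/-- The action of `y_i` on the free module on the admissible words. -/
noncomputable def Y (i : Fin n) : D.Mod →ₗ[k] D.Mod :=
  D.skewExt i fun K => D.act K.length i (D.e K)

theorem Y_smul (i : Fin n) (a : R) (m : D.Mod) :
    D.Y i (a • m) = D.σ i a • D.Y i m + D.δ i a • m :=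
  D.isSkew_skewExt i _ a m

theorem Y_e (i : Fin n) (K : D.Adm) (d : ℕ) (h : K.length ≤ d) :
    D.Y i (D.e K) = D.act d i (D.e K) := by
  induction d, h using Nat.le_induction with
  | base => simp [Y]
  | succ d hd ih => rw [ih, D.act_succ_eq d K hd]

theorem Y_of_fits {i : Fin n} {K : D.Adm} (h : K.Fits i) :
    D.Y i (D.e K) = D.e (Adm.cons i K h) := by
  rw [D.Y_e i K _ le_rfl, D.act_of_fits _ _ _ h]

theorem Y_mem_low {i l : Fin n} {K : D.Adm} (hl : l < i) (h : K.Fits l) :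
    D.Y i (D.e K) ∈ D.low l K.length := by
  rw [D.Y_e i K _ le_rfl]
  exact (D.act_mem _ K le_rfl i).2 l hl h

theorem Y_self {i : Fin n} {J : D.Adm} (h : J.Fits i) (hs : D.s i i ≠ 1) :
    D.Y i (D.Y i (D.e J)) = (2⁻¹ : k) • ∑ r, D.c i i r • D.Y r (D.e J) := by
  rw [D.Y_of_fits h, D.Y_e i _ (J.length + 1) (by simp), D.act_succ_self _ i J h hs]
  simp only [D.Y_e _ J _ le_rfl]

theorem Y_of_lt {i l : Fin n} {J : D.Adm} (h : J.Fits l) (hl : l < i) :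
    D.Y i (D.Y l (D.e J)) = D.s i l • D.Y l (D.Y i (D.e J)) + ∑ r, D.c i l r • D.Y r (D.e J) := by
  rw [D.Y_of_fits h, D.Y_e i _ (J.length + 1) (by simp), D.act_succ_of_lt _ J h hl]
  simp only [D.Y_e _ J _ le_rfl]
  congr 2
  refine ((D.isSkew_skewExt l _).eqOn_span (D.isSkew_act _ l) ?_ _
    ((D.act_mem _ J le_rfl i).2 l hl h)).symm
  rintro _ ⟨K', rfl, hK' | ⟨hK', hf'⟩⟩
  · exact D.Y_e l K' _ hK'
  · rw [D.act_of_fits _ _ _ hf']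
    exact D.Y_of_fits hf'

end SkewData

/-! ### The operators satisfy the commutation relations. -/

namespace SkewData

open Finsupp

variable {k R : Type*} [Field k] [Ring R] [Algebra k R] {n : ℕ} (D : SkewData k R n)

/-- The action of the linear combination `∑ r, v_r y_r`. -/
noncomputable def lin (v : Fin n → R) : D.Mod →ₗ[k] D.Mod where
  toFun m := ∑ r, v r • D.Y r m
  map_add' m m' := by simp [Finset.sum_add_distrib]
  map_smul' t m := by simp [Finset.smul_sum, smul_comm t]

theorem lin_apply (v : Fin n → R) (m : D.Mod) : D.lin v m = ∑ r, v r • D.Y r m := rfl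

theorem lin_add (v w : Fin n → R) (m : D.Mod) : D.lin (v + w) m = D.lin v m + D.lin w m := by
  simp [lin_apply, add_smul, Finset.sum_add_distrib]

theorem lin_smul (t : k) (v : Fin n → R) (m : D.Mod) : D.lin (t • v) m = t • D.lin v m := by
  simp [lin_apply, Finset.smul_sum, smul_assoc]

theorem lin_zero (m : D.Mod) : D.lin 0 m = 0 := by
  simp [lin_apply]

/-- The bracket of `y_i` with `∑ r, v_r y_r`. -/
def br (i : Fin n) (v : Fin n → R) : Fin n → R :=
  fun t => D.δ i (v t) + ∑ r, D.σ i (v r) * D.c i r t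

/-- The commutation relation of `y_i` and `y_j` holds at `m`. -/
def CommAt (i j : Fin n) (m : D.Mod) : Prop :=
  D.Y i (D.Y j m) = D.s i j • D.Y j (D.Y i m) + D.lin (D.c i j) m

theorem s_mul_self (i j : Fin n) : D.s i j * D.s i j = 1 := by
  rcases D.s_sign i j with h | h <;> simp [h]

theorem σ_δ (i j : Fin n) (a : R) : D.σ i (D.δ j a) = D.s i j • D.δ j (D.σ i a) := by
  rw [D.δ_σ, D.s_symm i j, smul_smul, D.s_mul_self, one_smul]

variable {D}

theorem CommAt.symm {i j : Fin n} {m : D.Mod} (h : D.CommAt i j m) : D.CommAt j i m := by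
  have hc : D.c i j = -(D.s i j • D.c j i) := funext fun r => D.c_antisymm i j r
  have hl : D.lin (D.c i j) m = -(D.s i j • D.lin (D.c j i) m) := by
    rw [hc, ← neg_smul, lin_smul, neg_smul]
  unfold CommAt at *
  rw [h, hl, D.s_symm i j, smul_add, smul_smul, smul_neg, smul_smul, D.s_mul_self]
  simp

theorem commAt_self_of_s_eq_one {i : Fin n} (hs : D.s i i = 1) (m : D.Mod) : D.CommAt i i m := by
  have hc : D.c i i = 0 := funext fun r => D.c_self i r hs
  rw [CommAt, hs, hc, lin_zero, one_smul, add_zero]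

theorem CommAt.add {i j : Fin n} {m m' : D.Mod} (h : D.CommAt i j m) (h' : D.CommAt i j m') :
    D.CommAt i j (m + m') := by
  unfold CommAt at *
  simp only [map_add, h, h', smul_add]
  abel

/-- Both sides expand by the Leibniz rule. The terms with one `σ` and one `δ` match by `δ_σ`, those
with two `δ` by `δ_δ`, and `σ_σ_mul_c` carries the scalar past the structure constants. Hence the
relation need only be checked on words. -/
theorem CommAt.smul {i j : Fin n} {m : D.Mod} (h : D.CommAt i j m) (a : R) :
    D.CommAt i j (a • m) := by
  unfold CommAt at *
  have hlin : D.lin (D.c i j) (a • m) =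
      D.σ i (D.σ j a) • D.lin (D.c i j) m + (∑ r, D.c i j r * D.δ r a) • m := by
    simp only [lin_apply, Y_smul, smul_add, smul_smul, Finset.sum_add_distrib, Finset.smul_sum,
      Finset.sum_smul, D.σ_σ_mul_c]
  rw [hlin]
  simp only [Y_smul, map_add, h, D.δ_δ i j a, D.δ_σ i j a, D.σ_δ i j a, smul_add, add_smul,
    smul_assoc, D.σ_comm j i a, smul_comm (D.s i j) (D.σ i (D.σ j a))]
  abel

theorem commAt_of_mem_span {i j : Fin n} {S : Set D.Mod} (h : ∀ m ∈ S, D.CommAt i j m) :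
    ∀ m ∈ Submodule.span R S, D.CommAt i j m := by
  intro m hm
  induction hm using Submodule.span_induction with
  | mem m hm => exact h m hm
  | zero => simp [CommAt]
  | add m m' _ _ h h' => exact h.add h'
  | smul a m _ h => exact h.smul a

theorem two_ne_zero_of_s_ne_one {i : Fin n} (hs : D.s i i ≠ 1) : (2 : k) ≠ 0 := by
  intro h
  rcases D.s_sign i i with h' | h'
  · exact hs h'
  · exact hs (by rw [h']; linear_combination -h)

/-- Here `y_j K` is itself a word, and the relation is the rewriting rule that defines `Y_i` on it.
-/
theorem commAt_of_fits {i j : Fin n} {K : D.Adm} (h : ¬ D.rel i j) (hK : K.Fits j) :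
    D.CommAt i j (D.e K) := by
  rcases D.not_rel h with hl | ⟨rfl, hs⟩
  · exact D.Y_of_lt hK hl
  · have h2 := two_ne_zero_of_s_ne_one hs
    rw [CommAt, D.Y_self hK hs, (D.s_sign i i).resolve_left hs, ← lin_apply, neg_smul, one_smul,
      eq_neg_add_iff_add_eq, ← two_smul k, smul_inv_smul₀ h2]

/-- Moving `y_i` past the combination `∑ r, c_jlr y_r`. -/
theorem Y_lin {i j l : Fin n} {m : D.Mod} (h : ∀ r, D.CommAt i r m) :
    D.Y i (D.lin (D.c j l) m) = (D.s i j * D.s i l) • D.lin (D.c j l) (D.Y i m) +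
      D.lin (D.br i (D.c j l)) m := by
  have e1 : (D.s i j * D.s i l) • D.lin (D.c j l) (D.Y i m) =
      ∑ r, (D.s i r • D.σ i (D.c j l r)) • D.Y r (D.Y i m) := by
    simp only [D.σ_c, lin_apply, Finset.smul_sum, smul_assoc]
  have e2 : D.lin (D.br i (D.c j l)) m =
      ∑ r, D.δ i (D.c j l r) • D.Y r m + ∑ r, D.σ i (D.c j l r) • D.lin (D.c i r) m := by
    simp only [lin_apply, br, add_smul, Finset.sum_add_distrib, Finset.smul_sum, Finset.sum_smul,
      smul_smul]
    congr 1
    exact Finset.sum_comm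
  rw [e1, e2, lin_apply, map_sum, ← add_assoc, ← Finset.sum_add_distrib, ← Finset.sum_add_distrib]
  refine Finset.sum_congr rfl fun r _ => ?_
  rw [Y_smul, h r, smul_add, smul_assoc, smul_comm (D.s i r)]
  abel

theorem lin_jacobi (i j l : Fin n) (m : D.Mod) :
    D.lin (D.br i (D.c j l)) m - D.s i j • D.lin (D.br j (D.c i l)) m +
      (D.s i l * D.s j l) • D.lin (D.br l (D.c i j)) m = 0 := by
  have h : D.br i (D.c j l) + (-D.s i j) • D.br j (D.c i l) +
      (D.s i l * D.s j l) • D.br l (D.c i j) = 0 := by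
    funext t
    have := D.jacobi i j l t
    rw [sub_eq_add_neg, ← neg_smul] at this
    exact this
  rw [sub_eq_add_neg, ← neg_smul, ← lin_smul, ← lin_smul, ← lin_add, ← lin_add, h, lin_zero]

theorem lin_jacobi_self {i : Fin n} (hs : D.s i i ≠ 1) (m : D.Mod) :
    D.lin (D.br i (D.c i i)) m = 0 := by
  have h : D.br i (D.c i i) = 0 := funext fun t => D.jacobi_self i t hs
  rw [h, lin_zero]

/-- The commutation relation at `y_l m` from those at `m`, `y_i m` and `y_j m`. -/
theorem commAt_Y {i j l : Fin n} {m : D.Mod} (h : ∀ i j, D.CommAt i j m)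
    (hj : D.CommAt i l (D.Y j m)) (hi : D.CommAt j l (D.Y i m)) : D.CommAt i j (D.Y l m) := by
  have hjac := lin_jacobi (D := D) i j l m
  have a1 := h j l
  have a2 := h i l
  have a3 := h i j
  unfold CommAt at hi hj a1 a2 a3 ⊢
  -- Every triple product is brought to the order `y_l y_j y_i`. The quadratic remainders cancel,
  -- and the linear ones sum to `lin_jacobi`.
  rw [a1, a2]
  simp only [map_add, map_smul, hi, hj, Y_lin (h i), Y_lin (h j), Y_lin (h l), a3]
  have b1 := D.s_symm i j
  have b2 := D.s_symm i l
  have b3 := D.s_symm j l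
  rcases D.s_sign i j with h1 | h1 <;> rcases D.s_sign i l with h2 | h2 <;>
    rcases D.s_sign j l with h3 | h3 <;>
    simp only [b1, b2, b3, h1, h2, h3] at hjac ⊢ <;> linear_combination (norm := module) hjac

/-- The commutation relation of `y_i` and `y_j` at `y_j m` for `y_j` of odd type. -/
theorem commAt_Y_right {i j : Fin n} {m : D.Mod} (hs : D.s j j ≠ 1) (h : ∀ i j, D.CommAt i j m)
    (hj : D.CommAt j j (D.Y i m)) : D.CommAt i j (D.Y j m) := by
  have hjac := lin_jacobi (D := D) i j j m
  have a3 := congrArg (D.Y i) (h j j)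
  have a4 := congrArg (D.Y j) (h i j)
  have h2 := two_ne_zero_of_s_ne_one hs
  have hs' := (D.s_sign j j).resolve_left hs
  unfold CommAt at hj ⊢
  simp only [map_add, map_smul, Y_lin (h i), Y_lin (h j), hs', D.s_symm i j] at a3 a4 hj hjac ⊢
  -- `commAt_Y` at `l = j` would presuppose the goal. Doubling instead lets the relation for `y_j
  -- y_j` at `m` replace `2 y_j²` by `∑ r, c_jjr y_r`.
  apply smul_right_injective D.Mod h2
  rcases D.s_sign i j with h1 | h1 <;> simp only [h1] at a3 a4 hj hjac ⊢
  · linear_combination (norm := module) a3 - (2 : k) • a4 - hj + hjac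
  · linear_combination (norm := module) a3 + (2 : k) • a4 - hj + hjac

/-- Apply `y_i` to the relation for `y_i²` at `m`: moving `y_i` past `∑ r, c_iir y_r` leaves exactly
the term that `jacobi_self` kills. -/
theorem commAt_Y_self {i : Fin n} {m : D.Mod} (hs : D.s i i ≠ 1) (h : ∀ i j, D.CommAt i j m) :
    D.CommAt i i (D.Y i m) := by
  have a := congrArg (D.Y i) (h i i)
  unfold CommAt at a ⊢
  rw [map_add, map_smul, Y_lin (h i), lin_jacobi_self hs, D.s_mul_self] at a
  linear_combination (norm := module) a

theorem commAt_e (d : ℕ) : ∀ K : D.Adm, K.length ≤ d → ∀ i j, D.CommAt i j (D.e K) := by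
  induction d using Nat.strong_induction_on with
  | _ d ih =>
  intro K hK
  have hlt : ∀ K' : D.Adm, K'.length < K.length → ∀ i j, D.CommAt i j (D.e K') :=
    fun K' hK' => ih _ (hK'.trans_le hK) K' le_rfl
  -- The relation is symmetric in `i` and `j`, and trivial for `i = j` with sign 1, so only pairs
  -- out of order matter.
  suffices key : ∀ i j, ¬ D.rel i j → D.CommAt i j (D.e K) by
    intro i j
    by_cases hr : D.rel i j
    · by_cases hr' : D.rel j i
      · rcases hr with hr | ⟨rfl, hs⟩
        · rcases hr' with hr' | ⟨rfl, hs⟩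
          exacts [absurd hr (lt_asymm hr'), absurd hr (lt_irrefl _)]
        · exact commAt_self_of_s_eq_one hs _
      · exact (key j i hr').symm
    · exact key i j hr
  intro i j hij
  by_cases hf : K.Fits j
  · exact commAt_of_fits hij hf
  obtain rfl | ⟨l, J, h, rfl⟩ := K.eq_nil_or_cons
  · exact absurd (Adm.fits_nil j) hf
  have hJ := hlt J (by simp)
  -- `y_j J` contains words as long as `K`, outside the induction hypothesis; those fit `l`, where
  -- the relation holds by construction.
  have hlow : ∀ {i j l : Fin n}, ¬ D.rel i l → l < j → J.Fits l →
      D.CommAt i l (D.Y j (D.e J)) := by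
    intro i j l hil hl h
    refine commAt_of_mem_span ?_ _ (D.Y_mem_low hl h)
    rintro _ ⟨K', rfl, hK' | ⟨hK', hf'⟩⟩
    · exact hlt K' (by simpa [Nat.lt_succ_iff] using hK') _ _
    · exact commAt_of_fits hil hf'
  have hrel : ∀ {a b : Fin n}, b < a → ¬ D.rel a b := fun hb h' => by
    rcases h' with h' | h'
    exacts [lt_asymm h' hb, hb.ne' h'.1]
  have hjl : ¬ D.rel j l := fun h' => hf (h.cons h')
  rw [← D.Y_of_fits h]
  rcases D.not_rel hjl with hl | ⟨rfl, hs⟩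
  · have hli : l < i := by
      rcases D.not_rel hij with h' | ⟨rfl, -⟩
      exacts [hl.trans h', hl]
    exact commAt_Y hJ (hlow (hrel hli) hl h) (hlow (hrel hl) hli h)
  · rcases D.not_rel hij with h' | ⟨rfl, -⟩
    · exact commAt_Y_right hs hJ (hlow hjl h' h)
    · exact commAt_Y_self hs hJ

theorem commAt (i j : Fin n) (m : D.Mod) : D.CommAt i j m := by
  obtain ⟨d, hd⟩ := D.exists_mem_fil m
  refine commAt_of_mem_span ?_ m hd
  rintro _ ⟨K, rfl, hK⟩
  exact commAt_e d K hK i j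

end SkewData

/-! ### Evaluation in an algebra satisfying the relations, and sorted words. -/

namespace SkewData

open Finsupp

variable {k R : Type*} [Field k] [Ring R] [Algebra k R] {n : ℕ} (D : SkewData k R n)
variable {B : Type*} [Ring B] [Algebra k B] (φ : R →ₐ[k] B) (y : Fin n → B)

/-- The evaluation `a ⊗ K ↦ φ(a) y^K`. -/
noncomputable def eval : D.Mod →ₗ[k] B :=
  Finsupp.lsum k fun K => LinearMap.mulRight k (K.1.map y).prod ∘ₗ φ.toLinearMap

@[simp] theorem eval_single (K : D.Adm) (a : R) :
    D.eval φ y (single K a) = φ a * (K.1.map y).prod := by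
  simp [eval]

theorem eval_e (K : D.Adm) : D.eval φ y (D.e K) = (K.1.map y).prod := by
  simp [e]

theorem eval_smul (a : R) (m : D.Mod) : D.eval φ y (a • m) = φ a * D.eval φ y m := by
  induction m using Finsupp.induction_linear with
  | zero => simp
  | add m m' h h' => rw [smul_add, map_add, h, h', map_add, mul_add]
  | single K b => rw [Finsupp.smul_single, eval_single, eval_single, smul_eq_mul, map_mul, mul_assoc]

variable {φ y}

theorem eval_Y_of_mem_span (hyx : ∀ i a, y i * φ a = φ (D.σ i a) * y i + φ (D.δ i a)) {i : Fin n}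
    {S : Set D.Mod} (h : ∀ m ∈ S, D.eval φ y (D.Y i m) = y i * D.eval φ y m) :
    ∀ m ∈ Submodule.span R S, D.eval φ y (D.Y i m) = y i * D.eval φ y m := by
  intro m hm
  induction hm using Submodule.span_induction with
  | mem m hm => exact h m hm
  | zero => simp
  | add m m' _ _ h h' => rw [map_add, map_add, h, h', map_add, mul_add]
  | smul a m _ h =>
    rw [Y_smul, map_add, eval_smul, eval_smul, eval_smul, h, ← mul_assoc (y i), hyx, add_mul,
      mul_assoc]

theorem eval_Y_of_fits {i : Fin n} {K : D.Adm} (h : K.Fits i) :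
    D.eval φ y (D.Y i (D.e K)) = y i * D.eval φ y (D.e K) := by
  rw [D.Y_of_fits h, eval_e, eval_e]
  simp [Adm.cons]

/-- Evaluation turns `Y_i` into left multiplication by `y_i`, since each rewriting rule defining
`Y_i` is an identity in `B`. -/
theorem eval_Y_e (hyx : ∀ i a, y i * φ a = φ (D.σ i a) * y i + φ (D.δ i a))
    (hyy : ∀ i j, y i * y j = D.s i j • (y j * y i) + ∑ r, φ (D.c i j r) * y r) (d : ℕ) :
    ∀ (K : D.Adm), K.length ≤ d → ∀ i, D.eval φ y (D.Y i (D.e K)) = y i * D.eval φ y (D.e K) := by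
  induction d with
  | zero =>
    intro K hK i
    obtain rfl | ⟨l, J, h, rfl⟩ := K.eq_nil_or_cons
    · exact D.eval_Y_of_fits (Adm.fits_nil i)
    · simp at hK
  | succ d ih =>
    intro K hK i
    by_cases hf : K.Fits i
    · exact D.eval_Y_of_fits hf
    obtain rfl | ⟨l, J, h, rfl⟩ := K.eq_nil_or_cons
    · exact absurd (Adm.fits_nil i) hf
    have hJ : J.length ≤ d := by simpa using hK
    have hr : ¬ D.rel i l := fun h' => hf (h.cons h')
    have hsum : ∀ c : Fin n → R, D.eval φ y (∑ r, c r • D.Y r (D.e J)) =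
        (∑ r, φ (c r) * y r) * D.eval φ y (D.e J) := fun c => by
      simp only [map_sum, eval_smul, ih J hJ, Finset.sum_mul, mul_assoc]
    rw [← D.Y_of_fits h, D.eval_Y_of_fits h]
    rcases D.not_rel hr with hl | ⟨rfl, hs⟩
    · have hlow : D.eval φ y (D.Y l (D.Y i (D.e J))) = y l * D.eval φ y (D.Y i (D.e J)) := by
        refine D.eval_Y_of_mem_span hyx ?_ _ (D.Y_mem_low hl h)
        rintro _ ⟨K', rfl, hK' | ⟨hK', hf'⟩⟩
        · exact ih K' (hK'.trans hJ) l
        · exact D.eval_Y_of_fits hf'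
      rw [D.Y_of_lt h hl, map_add, map_smul, hlow, ih J hJ, hsum, ← mul_assoc, ← mul_assoc, hyy i l,
        add_mul, smul_mul_assoc]
    · have h2 := two_ne_zero_of_s_ne_one hs
      have hii := hyy i i
      rw [(D.s_sign i i).resolve_left hs, neg_smul, one_smul, eq_neg_add_iff_add_eq,
        ← two_smul k] at hii
      rw [D.Y_self h hs, map_smul, hsum, ← mul_assoc, ← hii, smul_mul_assoc, inv_smul_smul₀ h2]

theorem eval_Y (hyx : ∀ i a, y i * φ a = φ (D.σ i a) * y i + φ (D.δ i a))
    (hyy : ∀ i j, y i * y j = D.s i j • (y j * y i) + ∑ r, φ (D.c i j r) * y r)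
    (i : Fin n) (m : D.Mod) : D.eval φ y (D.Y i m) = y i * D.eval φ y m := by
  obtain ⟨d, hd⟩ := D.exists_mem_fil m
  refine D.eval_Y_of_mem_span hyx ?_ m hd
  rintro _ ⟨K, rfl, hK⟩
  exact D.eval_Y_e hyx hyy d K hK i

/-- The image contains 1, the value at the empty word, and is stable under left multiplication by
generators. -/
theorem eval_surjective (hyx : ∀ i a, y i * φ a = φ (D.σ i a) * y i + φ (D.δ i a))
    (hyy : ∀ i j, y i * y j = D.s i j • (y j * y i) + ∑ r, φ (D.c i j r) * y r)
    (hgen : Algebra.adjoin k (Set.range φ ∪ Set.range y) = ⊤) :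
    Function.Surjective (D.eval φ y) := by
  have key : ∀ b ∈ Algebra.adjoin k (Set.range φ ∪ Set.range y),
      ∀ m, ∃ m', D.eval φ y m' = b * D.eval φ y m := by
    intro b hb
    induction hb using Algebra.adjoin_induction with
    | mem b hb =>
      intro m
      rcases hb with ⟨a, rfl⟩ | ⟨i, rfl⟩
      · exact ⟨a • m, D.eval_smul φ y a m⟩
      · exact ⟨D.Y i m, D.eval_Y hyx hyy i m⟩
    | algebraMap t => exact fun m => ⟨t • m, by rw [map_smul, Algebra.smul_def]⟩
    | add b b' _ _ h h' =>
      intro m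
      obtain ⟨m₁, h₁⟩ := h m
      obtain ⟨m₂, h₂⟩ := h' m
      exact ⟨m₁ + m₂, by rw [map_add, h₁, h₂, add_mul]⟩
    | mul b b' _ _ h h' =>
      intro m
      obtain ⟨m₁, h₁⟩ := h' m
      obtain ⟨m₂, h₂⟩ := h m₁
      exact ⟨m₂, by rw [h₂, h₁, mul_assoc]⟩
  intro b
  obtain ⟨m, hm⟩ := key b (hgen ▸ Algebra.mem_top) (D.e Adm.nil)
  rw [eval_e] at hm
  exact ⟨m, by simpa [Adm.nil] using hm⟩

/-- Acting on the empty word is a left inverse: `y^K` builds `K` letter by letter, each one fitting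
the word to its right. -/
theorem eval_injective (ρ : B →ₐ[k] Module.End k D.Mod) (hφ : ∀ a m, ρ (φ a) m = a • m)
    (hy : ∀ i, ρ (y i) = D.Y i) : Function.Injective (D.eval φ y) := by
  have hK : ∀ (l : List (Fin n)) (hl : l.Pairwise D.rel),
      ρ (l.map y).prod (D.e Adm.nil) = D.e ⟨l, hl⟩ := by
    intro l
    induction l with
    | nil => intro _; simp [Adm.nil]
    | cons i l ih =>
      intro hl
      have h := List.pairwise_cons.1 hl
      rw [List.map_cons, List.prod_cons, map_mul, Module.End.mul_apply, ih h.2, hy]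
      exact D.Y_of_fits (K := ⟨l, h.2⟩) h.1
  have h : ∀ m, ρ (D.eval φ y m) (D.e Adm.nil) = m := by
    intro m
    induction m using Finsupp.induction_linear with
    | zero => simp
    | add m m' h h' => rw [map_add, map_add, LinearMap.add_apply, h, h']
    | single K a =>
      rw [eval_single, map_mul, Module.End.mul_apply, hK K.1 K.2, hφ]
      change a • single K (1 : R) = single K a
      rw [Finsupp.smul_single, smul_eq_mul, mul_one]
  intro m m' hm
  rw [← h m, hm, h]

/-- An algebra presented by the relations of `D` is free over `R` on the admissible words. -/
noncomputable def evalEquiv (hyx : ∀ i a, y i * φ a = φ (D.σ i a) * y i + φ (D.δ i a))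
    (hyy : ∀ i j, y i * y j = D.s i j • (y j * y i) + ∑ r, φ (D.c i j r) * y r)
    (hgen : Algebra.adjoin k (Set.range φ ∪ Set.range y) = ⊤)
    (ρ : B →ₐ[k] Module.End k D.Mod) (hφ : ∀ a m, ρ (φ a) m = a • m)
    (hy : ∀ i, ρ (y i) = D.Y i) : D.Mod ≃ₗ[k] B :=
  LinearEquiv.ofBijective (D.eval φ y)
    ⟨D.eval_injective ρ hφ hy, D.eval_surjective hyx hyy hgen⟩

/-- The sorted word with prescribed multiplicities. -/
def sortedWord (J : Fin n → ℕ) : List (Fin n) :=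
  (List.finRange n).flatMap fun r => List.replicate (J r) r

theorem count_sortedWord (J : Fin n → ℕ) (r : Fin n) : (sortedWord J).count r = J r := by
  rw [sortedWord, List.count_flatMap, ← List.ofFn_eq_map, List.sum_ofFn]
  simp [List.count_replicate]

theorem prod_map_sortedWord (J : Fin n → ℕ) (z : Fin n → B) :
    ((sortedWord J).map z).prod = (List.ofFn fun r => z r ^ J r).prod := by
  rw [sortedWord, List.ofFn_eq_map]
  induction List.finRange n with
  | nil => simp
  | cons r l ih => simp [List.flatMap_cons, ih]

theorem pairwise_sortedWord {J : Fin n → ℕ} (hJ : ∀ r, D.s r r ≠ 1 → J r ≤ 1) :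
    (sortedWord J).Pairwise D.rel := by
  rw [sortedWord, List.pairwise_flatMap]
  refine ⟨fun r _ => ?_, ?_⟩
  · rw [List.pairwise_replicate]
    by_cases h : D.s r r = 1
    · exact Or.inr (Or.inr ⟨rfl, h⟩)
    · exact Or.inl (hJ r h)
  · refine (List.pairwise_lt_finRange n).imp fun {a b} hab x hx z hz => ?_
    rw [List.eq_of_mem_replicate hx, List.eq_of_mem_replicate hz]
    exact Or.inl hab

/-- Admissible words correspond to exponent vectors. -/
noncomputable def expEquiv : {J : Fin n → ℕ // ∀ r, D.s r r ≠ 1 → J r ≤ 1} ≃ D.Adm :=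
  Equiv.ofBijective (fun J => ⟨sortedWord J.1, D.pairwise_sortedWord J.2⟩) (by
    constructor
    · intro J J' h
      have h' : sortedWord J.1 = sortedWord J'.1 := congrArg Subtype.val h
      ext r
      rw [← count_sortedWord J.1 r, h', count_sortedWord]
    · rintro ⟨K, hK⟩
      have hc : ∀ r, D.s r r ≠ 1 → K.count r ≤ 1 := by
        intro r hr
        by_contra! h
        -- Two occurrences of `r` give the sublist `[r, r]`, which would make `r` related to itself.
        have h' := hK.sublist (List.replicate_sublist_iff.2 h)
        rcases (List.pairwise_cons.1 h').1 r (by simp) with h' | h'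
        exacts [lt_irrefl _ h', hr h'.2]
      refine ⟨⟨fun r => K.count r, hc⟩, Subtype.ext ?_⟩
      refine List.Perm.eq_of_pairwise ?_ (D.pairwise_sortedWord hc) hK ?_
      · rintro a b - - (h | h) (h' | h')
        exacts [absurd h (lt_asymm h'), h'.1.symm, h.1, h.1]
      · exact List.perm_iff_count.2 fun r => count_sortedWord _ r)

end SkewData

/-! ### Signs, the graded polynomial algebra and its monomial basis. -/

namespace DGP

variable {k : Type*} [Field k] {n : ℕ} {deg : Fin n → ℤ}

theorem neg_one_zpow_congr {a b : ℤ} (h : Even (a - b)) : (-1 : k) ^ a = (-1 : k) ^ b := by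
  have : a = (a - b) + b := by ring
  rw [this, zpow_add₀ (by simp), h.neg_one_zpow, one_mul]

theorem neg_one_zpow_mul (a b : ℤ) : (-1 : k) ^ a * (-1 : k) ^ b = (-1 : k) ^ (a + b) :=
  (zpow_add₀ (by simp) a b).symm

theorem neg_one_zpow_eq_or (a : ℤ) : (-1 : k) ^ a = 1 ∨ (-1 : k) ^ a = -1 := by
  rcases Int.even_or_odd a with h | h
  exacts [Or.inl h.neg_one_zpow, Or.inr h.neg_one_zpow]

/-- A self-commutation sign is nontrivial exactly in odd degree away from characteristic two. -/
theorem sign_self_ne_one_iff (a : ℤ) : (-1 : k) ^ (a * a) ≠ 1 ↔ Odd a ∧ (2 : k) ≠ 0 := by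
  rcases Int.even_or_odd a with h | h
  · simp [(h.mul_left a).neg_one_zpow, Int.not_odd_iff_even.2 h]
  · rw [(h.mul h).neg_one_zpow]
    refine ⟨fun h' => ⟨h, fun h2 => h' ?_⟩, fun h' h2 => h'.2 ?_⟩
    · linear_combination -h2
    · linear_combination -h2

theorem Poly.induction_homogeneous {C : Poly k deg → Prop}
    (homog : ∀ (p : ℤ) (a : Poly k deg), a ∈ Poly.comp k deg p → C a)
    (add : ∀ a b, C a → C b → C (a + b)) (a : Poly k deg) : C a :=
  DirectSum.Decomposition.inductionOn (Poly.comp k deg) (homog 0 0 (Submodule.zero_mem _))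
    (fun {i} m => homog i m m.2) add a

theorem Poly.adjoin_range_x : Algebra.adjoin k (Set.range (Poly.x k deg)) = ⊤ := by
  let S := Algebra.adjoin k (Set.range (Poly.x k deg))
  let f : Poly k deg →ₐ[k] S := Poly.lift k deg
    (fun i => ⟨Poly.x k deg i, Algebra.subset_adjoin ⟨i, rfl⟩⟩)
    (fun i j => Subtype.ext (Poly.x_comm k deg i j))
  have h : S.val.comp f = AlgHom.id k _ := Poly.hom_ext k deg fun i => by simp [f]
  refine Algebra.eq_top_iff.2 fun a => ?_
  have := DFunLike.congr_fun h a
  rw [← AlgHom.id_apply (R := k) a, ← this]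
  exact (f a).2

/-- Induction along left multiplication by generators. -/
theorem Poly.induction_mul {C : Poly k deg → Prop} (one : C 1)
    (add : ∀ a b, C a → C b → C (a + b)) (smul : ∀ (t : k) a, C a → C (t • a))
    (x_mul : ∀ (i : Fin n) (p : ℤ) (a : Poly k deg), a ∈ Poly.comp k deg p → C a →
      C (Poly.x k deg i * a)) (a : Poly k deg) : C a := by
  have hw : ∀ l : List (Fin n), C (l.map (Poly.x k deg)).prod := by
    intro l
    induction l with
    | nil => simpa using one
    | cons i l ih => simpa using x_mul i _ _ (Poly.word_mem k deg l) ih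
  refine Poly.induction_homogeneous (fun p a ha => ?_) add a
  induction ha using Submodule.span_induction with
  | mem a h => obtain ⟨l, -, rfl⟩ := h; exact hw l
  | zero => simpa using smul 0 1 one
  | add a b _ _ h h' => exact add _ _ h h'
  | smul t a _ h => exact smul t a h

/-- The automorphism `a ↦ (-1)^{|x_i||a|} a`. -/
noncomputable def Poly.sigma (i : Fin n) : Poly k deg →ₐ[k] Poly k deg :=
  Poly.lift k deg (fun j => (-1 : k) ^ (deg i * deg j) • Poly.x k deg j) fun j l => by
    simp only [smul_mul_smul_comm, Poly.x_comm k deg j l, smul_smul]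
    congr 1
    ring

theorem Poly.sigma_of_mem (i : Fin n) {p : ℤ} {a : Poly k deg} (ha : a ∈ Poly.comp k deg p) :
    Poly.sigma i a = (-1 : k) ^ (deg i * p) • a := by
  induction ha using Submodule.span_induction with
  | mem a h =>
    obtain ⟨l, rfl, rfl⟩ := h
    induction l with
    | nil => simp
    | cons j l ih =>
      simp only [List.map_cons, List.prod_cons, List.sum_cons, map_mul, ih]
      rw [Poly.sigma, Poly.lift_x, smul_mul_smul_comm, neg_one_zpow_mul, mul_add]
  | zero => simp
  | add a b _ _ h h' => rw [map_add, h, h', smul_add]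
  | smul t a _ h => rw [map_smul, h, smul_comm]

theorem Poly.psi_mem (r : Fin n) {p : ℤ} {a : Poly k deg} (ha : a ∈ Poly.comp k deg p) :
    Poly.psi k deg r a ∈ Poly.comp k deg (p - deg r) :=
  (Poly.psiMatrix_of_mem k deg r ha).2.2.2

theorem Poly.psi_one (r : Fin n) : Poly.psi k deg r 1 = 0 := by
  simp [Poly.psi]

/-- The structure constants of `R` as an extension of `k`. -/
noncomputable def polyData (k : Type*) [Field k] {n : ℕ} (deg : Fin n → ℤ) : SkewData k k n where
  s i j := (-1 : k) ^ (deg i * deg j)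
  σ _ := AlgHom.id k k
  δ _ := 0
  c _ _ _ := 0
  s_symm i j := by rw [mul_comm]
  s_sign i j := neg_one_zpow_eq_or _
  σ_comm := by simp
  δ_mul := by simp
  δ_σ := by simp
  δ_δ := by simp
  σ_σ_mul_c := by simp
  σ_c := by simp
  c_antisymm := by simp
  c_self := by simp
  jacobi := by simp
  jacobi_self := by simp

/-- The action of `R` on the free module on the admissible words. -/
noncomputable def polyAction (k : Type*) [Field k] {n : ℕ} (deg : Fin n → ℤ) :
    Poly k deg →ₐ[k] Module.End k (polyData k deg).Mod :=
  Poly.lift k deg (polyData k deg).Y fun i j => by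
    ext1 K
    ext1
    have h := SkewData.commAt (D := polyData k deg) i j (Finsupp.single K 1)
    have hc : (polyData k deg).c i j = 0 := rfl
    rw [SkewData.CommAt, hc, SkewData.lin_zero, add_zero] at h
    exact h

/-- The ordered monomials form a basis of `R`. -/
noncomputable def polyBasis (k : Type*) [Field k] {n : ℕ} (deg : Fin n → ℤ) :
    Module.Basis (polyData k deg).Adm k (Poly k deg) :=
  Finsupp.basisSingleOne.map <| (polyData k deg).evalEquiv (φ := Algebra.ofId k (Poly k deg))
    (y := Poly.x k deg)
    (fun i a => by
      have : Algebra.ofId k (Poly k deg) ((polyData k deg).δ i a) = 0 := by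
        rw [show (polyData k deg).δ i a = 0 from rfl, map_zero]
      rw [this, add_zero]
      exact (Algebra.commutes a _).symm)
    (fun i j => by
      have : ∀ r, Algebra.ofId k (Poly k deg) ((polyData k deg).c i j r) * Poly.x k deg r = 0 :=
        fun r => by rw [show (polyData k deg).c i j r = 0 from rfl, map_zero, zero_mul]
      rw [Finset.sum_eq_zero fun r _ => this r, add_zero]
      exact Poly.x_comm k deg i j)
    (top_le_iff.1 (Poly.adjoin_range_x.ge.trans
      (Algebra.adjoin_mono Set.subset_union_right)))
    (polyAction k deg)
    (fun a m => by
      rw [show Algebra.ofId k (Poly k deg) a = algebraMap k _ a from rfl, AlgHom.commutes,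
        Module.algebraMap_end_apply])
    (fun i => Poly.lift_x k deg _ _ i)

theorem polyBasis_apply (K : (polyData k deg).Adm) :
    polyBasis k deg K = (K.1.map (Poly.x k deg)).prod := by
  rw [polyBasis, Module.Basis.map_apply, Finsupp.coe_basisSingleOne]
  exact SkewData.eval_e _ _ _ K

/-! ### Bracket identities and the anti-differentials. -/

namespace DGPoisson

variable (P : DGPoisson (Poly.comp k deg))

theorem bracket_x_mem (i : Fin n) {p : ℤ} {a : Poly k deg} (ha : a ∈ Poly.comp k deg p) :
    P.bracket (Poly.x k deg i) a ∈ Poly.comp k deg (deg i + p) :=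
  P.bracket_mem (Poly.x_mem k deg i) ha

theorem bracket_one_left {p : ℤ} {a : Poly k deg} (ha : a ∈ Poly.comp k deg p) :
    P.bracket 1 a = 0 := by
  have h1 : (1 : Poly k deg) ∈ Poly.comp k deg 0 := SetLike.GradedOne.one_mem
  have h := P.bracket_mul ha h1 h1
  rw [P.antisymm h1 ha]
  simpa using h

/-- In its left argument the bracket obeys the same product rule as `ψ_r`; this is what makes
`bracket_eq_sum` true. -/
theorem bracket_mul_left {p q r : ℤ} {a f g : Poly k deg} (ha : a ∈ Poly.comp k deg p)
    (hf : f ∈ Poly.comp k deg q) (hg : g ∈ Poly.comp k deg r) :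
    P.bracket (f * g) a =
      f * P.bracket g a + (-1 : k) ^ (q * r) • (g * P.bracket f a) := by
  rw [P.antisymm (SetLike.mul_mem_graded hf hg) ha, P.bracket_mul ha hf hg, P.antisymm hg ha,
    P.antisymm hf ha, Poly.graded_comm k deg (P.bracket_mem ha hf) hg]
  simp only [mul_neg, smul_neg, mul_smul_comm, smul_smul, smul_add, neg_one_zpow_mul, neg_add]
  rw [add_comm]
  congr 3
  · exact neg_one_zpow_congr ⟨p * q, by ring⟩
  · exact neg_one_zpow_congr ⟨p * r, by ring⟩

/-- The bracket is determined by the brackets with generators. -/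
theorem bracket_eq_sum (f a : Poly k deg) :
    P.bracket f a = ∑ r, Poly.psi k deg r f * P.bracket (Poly.x k deg r) a := by
  induction a using Poly.induction_homogeneous with
  | add a b ha hb => simp only [map_add, ha, hb, mul_add, Finset.sum_add_distrib]
  | homog p a ha =>
    induction f using Poly.induction_mul with
    | one => simp [P.bracket_one_left ha, Poly.psi_one]
    | add f g hf hg =>
      simp only [map_add, LinearMap.add_apply, hf, hg, add_mul, Finset.sum_add_distrib]
    | smul t f hf => simp only [map_smul, LinearMap.smul_apply, hf, smul_mul_assoc, Finset.smul_sum]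
    | x_mul i q f hf ih =>
      rw [P.bracket_mul_left ha (Poly.x_mem k deg i) hf, ih]
      simp only [Poly.psi_mul k deg _ (Poly.x_mem k deg i) hf, Poly.psi_x, add_mul,
        Finset.sum_add_distrib, Finset.mul_sum, mul_assoc]
      simp [ite_mul, Finset.sum_ite_eq']

/-- The compatibility of the bracket with the differentials `ψ_t`. -/
theorem psi_bracket (i t : Fin n) (f : Poly k deg) :
    Poly.psi k deg t (P.bracket (Poly.x k deg i) f) =
      P.bracket (Poly.x k deg i) (Poly.psi k deg t f) +
        ∑ r, Poly.sigma i (Poly.psi k deg r f) *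
          Poly.psi k deg t (P.bracket (Poly.x k deg i) (Poly.x k deg r)) := by
  have hx := Poly.x_mem k deg i
  have h1 : (1 : Poly k deg) ∈ Poly.comp k deg 0 := SetLike.GradedOne.one_mem
  have hb1 : P.bracket (Poly.x k deg i) 1 = 0 := by
    rw [P.antisymm hx h1, P.bracket_one_left hx]; simp
  induction f using Poly.induction_mul with
  | one => simp [hb1, Poly.psi_one]
  | add f g hf hg =>
    simp only [map_add, hf, hg, add_mul, Finset.sum_add_distrib]; abel
  | smul t f hf => simp only [map_smul, hf, smul_mul_assoc, Finset.smul_sum, smul_add]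
  | x_mul j q f hf ih =>
    have hj := Poly.x_mem k deg j
    have hbj := P.bracket_mem hx hj
    have hbf := P.bracket_mem hx hf
    have hsum : ∑ r, Poly.sigma i (Poly.psi k deg r (Poly.x k deg j * f)) *
          Poly.psi k deg t (P.bracket (Poly.x k deg i) (Poly.x k deg r)) =
        (-1 : k) ^ (deg i * deg j) • (Poly.x k deg j * ∑ r, Poly.sigma i (Poly.psi k deg r f) *
          Poly.psi k deg t (P.bracket (Poly.x k deg i) (Poly.x k deg r))) +
        (-1 : k) ^ (deg j * q + deg i * q) •
          (f * Poly.psi k deg t (P.bracket (Poly.x k deg i) (Poly.x k deg j))) := by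
      simp only [Poly.psi_mul k deg _ hj hf, Poly.psi_x, map_add, map_mul, map_smul,
        Poly.sigma_of_mem i hj, Poly.sigma_of_mem i hf, add_mul, Finset.sum_add_distrib,
        Finset.mul_sum, Finset.smul_sum, smul_mul_assoc, mul_assoc, smul_smul, neg_one_zpow_mul]
      simp [apply_ite, ite_mul, Finset.sum_ite_eq']
    rw [hsum, P.bracket_mul hx hj hf, map_add, map_smul, Poly.psi_mul k deg t hbj hf,
      Poly.psi_mul k deg t hj hbf, ih, Poly.psi_mul k deg t hj hf, map_add, map_smul,
      P.bracket_mul hx hj (Poly.psi_mem t hf)]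
    -- `ψ_t(x_j)` is 0 or 1, so it contributes no bracket term.
    have hψ : P.bracket (Poly.x k deg i) (f * Poly.psi k deg t (Poly.x k deg j)) =
        P.bracket (Poly.x k deg i) f * Poly.psi k deg t (Poly.x k deg j) := by
      rw [Poly.psi_x]; split_ifs <;> simp
    have e₁ : (-1 : k) ^ ((deg i + deg j) * q) = (-1 : k) ^ (deg j * q + deg i * q) :=
      neg_one_zpow_congr ⟨0, by ring⟩
    have e₂ : (-1 : k) ^ (deg i * deg j + (deg j * deg i + deg j * q)) = (-1 : k) ^ (deg j * q) :=
      neg_one_zpow_congr ⟨deg i * deg j, by ring⟩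
    simp only [hψ, e₁, e₂, mul_add, smul_add, smul_smul, neg_one_zpow_mul]
    abel

end DGPoisson

end DGP

/-! ### Structure constants of `R^e` over `R`. -/

namespace DGP

variable {k : Type*} [Field k] {n : ℕ} {deg : Fin n → ℤ}

namespace DGPoisson

variable (P : DGPoisson (Poly.comp k deg))

theorem psi_bracket_x_mem (i j r : Fin n) :
    Poly.psi k deg r (P.bracket (Poly.x k deg i) (Poly.x k deg j)) ∈
      Poly.comp k deg (deg i + deg j - deg r) :=
  Poly.psi_mem r (P.bracket_x_mem i (Poly.x_mem k deg j))

theorem bracket_x_mul (i : Fin n) (a b : Poly k deg) :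
    P.bracket (Poly.x k deg i) (a * b) =
      P.bracket (Poly.x k deg i) a * b + Poly.sigma i a * P.bracket (Poly.x k deg i) b := by
  induction a using Poly.induction_homogeneous with
  | add a a' h h' => simp only [add_mul, map_add, h, h']; abel
  | homog p a ha =>
    induction b using Poly.induction_homogeneous with
    | add b b' h h' => simp only [mul_add, map_add, h, h']; abel
    | homog q b hb =>
      rw [P.bracket_mul (Poly.x_mem k deg i) ha hb, Poly.sigma_of_mem i ha, smul_mul_assoc]

/-- The Jacobi identity, with `{{x_i, x_j}, a}` expanded by `bracket_eq_sum`; this explains the term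
`ψ({x_i, x_j})` in the relations of `R^e`. -/
theorem bracket_x_bracket_x (i j : Fin n) (a : Poly k deg) :
    P.bracket (Poly.x k deg i) (P.bracket (Poly.x k deg j) a) =
      (-1 : k) ^ (deg i * deg j) • P.bracket (Poly.x k deg j) (P.bracket (Poly.x k deg i) a) +
        ∑ r, Poly.psi k deg r (P.bracket (Poly.x k deg i) (Poly.x k deg j)) *
          P.bracket (Poly.x k deg r) a := by
  rw [← P.bracket_eq_sum]
  induction a using Poly.induction_homogeneous with
  | add a a' h h' => simp only [map_add, smul_add, h, h']; abel
  | homog p a ha =>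
    rw [P.jacobi (Poly.x_mem k deg i) (Poly.x_mem k deg j) ha, add_comm]

theorem bracket_x_self (h2 : (2 : k) = 0 → ∀ i, P.bracket (Poly.x k deg i) (Poly.x k deg i) = 0)
    {i : Fin n} (hs : (-1 : k) ^ (deg i * deg i) = 1) :
    P.bracket (Poly.x k deg i) (Poly.x k deg i) = 0 := by
  by_cases h : (2 : k) = 0
  · exact h2 h i
  · have ha := P.antisymm (Poly.x_mem k deg i) (Poly.x_mem k deg i)
    rw [hs, one_smul, eq_neg_iff_add_eq_zero, ← two_smul k] at ha
    exact (smul_eq_zero.1 ha).resolve_left h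

theorem jacobi_x (i j l : Fin n) :
    P.bracket (Poly.x k deg i) (P.bracket (Poly.x k deg j) (Poly.x k deg l)) -
      (-1 : k) ^ (deg i * deg j) •
        P.bracket (Poly.x k deg j) (P.bracket (Poly.x k deg i) (Poly.x k deg l)) +
      ((-1 : k) ^ (deg i * deg l) * (-1 : k) ^ (deg j * deg l)) •
        P.bracket (Poly.x k deg l) (P.bracket (Poly.x k deg i) (Poly.x k deg j)) = 0 := by
  have hx := Poly.x_mem k deg
  rw [P.jacobi (hx i) (hx j) (hx l), P.antisymm (P.bracket_mem (hx i) (hx j)) (hx l),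
    neg_one_zpow_mul, ← add_mul]
  abel

/-- With sign `-1` the three Jacobi terms coincide and give three times the bracket. -/
theorem bracket_x_bracket_x_self (h3 : (3 : k) = 0 → ∀ i, Odd (deg i) →
      P.bracket (Poly.x k deg i) (P.bracket (Poly.x k deg i) (Poly.x k deg i)) = 0)
    {i : Fin n} (hs : (-1 : k) ^ (deg i * deg i) ≠ 1) :
    P.bracket (Poly.x k deg i) (P.bracket (Poly.x k deg i) (Poly.x k deg i)) = 0 := by
  by_cases h : (3 : k) = 0
  · exact h3 h i ((sign_self_ne_one_iff _).1 hs).1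
  · have hj := P.jacobi_x i i i
    rw [(neg_one_zpow_eq_or _).resolve_left hs] at hj
    have hj' : (3 : k) • P.bracket (Poly.x k deg i)
        (P.bracket (Poly.x k deg i) (Poly.x k deg i)) = 0 := by
      linear_combination (norm := module) hj
    exact (smul_eq_zero.1 hj').resolve_left h

/-- The structure constants of `R^e` as an extension of `R`. -/
noncomputable def envData
    (h2 : (2 : k) = 0 → ∀ i, P.bracket (Poly.x k deg i) (Poly.x k deg i) = 0)
    (h3 : (3 : k) = 0 → ∀ i, Odd (deg i) →
      P.bracket (Poly.x k deg i) (P.bracket (Poly.x k deg i) (Poly.x k deg i)) = 0) :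
    SkewData k (Poly k deg) n where
  s i j := (-1 : k) ^ (deg i * deg j)
  σ := Poly.sigma
  δ i := P.bracket (Poly.x k deg i)
  c i j r := Poly.psi k deg r (P.bracket (Poly.x k deg i) (Poly.x k deg j))
  s_symm i j := by rw [mul_comm]
  s_sign i j := neg_one_zpow_eq_or _
  σ_comm i j a := by
    induction a using Poly.induction_homogeneous with
    | add a a' h h' => simp only [map_add, h, h']
    | homog p a ha =>
      simp only [Poly.sigma_of_mem _ ha, map_smul]
      rw [smul_comm]
  δ_mul := P.bracket_x_mul
  δ_σ i j a := by
    induction a using Poly.induction_homogeneous with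
    | add a a' h h' => simp only [map_add, smul_add, h, h']
    | homog p a ha =>
      rw [Poly.sigma_of_mem _ ha, map_smul, Poly.sigma_of_mem _ (P.bracket_x_mem i ha), smul_smul,
        neg_one_zpow_mul]
      congr 1
      exact neg_one_zpow_congr ⟨-(deg i * deg j), by ring⟩
  δ_δ := P.bracket_x_bracket_x
  σ_σ_mul_c i j r a := by
    induction a using Poly.induction_homogeneous with
    | add a a' h h' => simp only [map_add, add_mul, mul_add, h, h']
    | homog p a ha =>
      simp only [Poly.sigma_of_mem _ ha, map_smul, smul_mul_assoc, mul_smul_comm, smul_smul]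
      rw [Poly.graded_comm k deg ha (P.psi_bracket_x_mem i j r), smul_smul, neg_one_zpow_mul,
        neg_one_zpow_mul]
      congr 1
      exact neg_one_zpow_congr ⟨deg j * p + deg i * p - deg r * p, by ring⟩
  σ_c i j l r := by
    rw [Poly.sigma_of_mem _ (P.psi_bracket_x_mem j l r), smul_smul, neg_one_zpow_mul,
      neg_one_zpow_mul]
    congr 1
    exact neg_one_zpow_congr ⟨0, by ring⟩
  c_antisymm i j r := by
    rw [P.antisymm (Poly.x_mem k deg i) (Poly.x_mem k deg j), map_neg, map_smul]
  c_self i r hs := by rw [P.bracket_x_self h2 hs, map_zero]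
  jacobi i j l t := by
    -- By `psi_bracket` each summand is `ψ_t` of a double bracket, so the condition is `ψ_t` applied
    -- to the Jacobi identity.
    simp only [← P.psi_bracket]
    have h := congrArg (Poly.psi k deg t) (P.jacobi_x i j l)
    rw [map_add, map_sub, map_smul, map_smul, map_zero] at h
    exact h
  jacobi_self i t hs := by
    rw [← P.psi_bracket, P.bracket_x_bracket_x_self h3 hs, map_zero]

end DGPoisson

/-! ### The presentation of `R^e` and its PBW basis. -/

section Env

variable {P : DGPoisson (Poly.comp k deg)}

theorem FreePoly.incl_x (i : Fin n) :
    FreePoly.incl k deg (Poly.x k deg i) =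
      RingQuot.mkAlgHom k (FreeRel k deg) (FreeAlgebra.ι k (Sum.inl i)) :=
  Poly.lift_x k deg _ _ i

theorem Env.yy (i j : Fin n) :
    Env.y P i * Env.y P j = (-1 : k) ^ (deg i * deg j) • (Env.y P j * Env.y P i) +
      ∑ r, Env.proj P (FreePoly.incl k deg
        (Poly.psi k deg r (P.bracket (Poly.x k deg i) (Poly.x k deg j)))) * Env.y P r := by
  have h := RingQuot.mkAlgHom_rel k (EnvRel.yy (P := P) i j)
  simp only [map_add, map_mul, map_smul, FreePoly.psi, map_sum] at h
  exact h

/-- The relation is imposed only for `a = x_j`. It passes to products because `σ_i` is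
multiplicative and `{x_i, ·}` is a `σ_i`-derivation. -/
theorem Env.yx (i : Fin n) (a : Poly k deg) :
    Env.y P i * Env.proj P (FreePoly.incl k deg a) =
      Env.proj P (FreePoly.incl k deg (Poly.sigma i a)) * Env.y P i +
        Env.proj P (FreePoly.incl k deg (P.bracket (Poly.x k deg i) a)) := by
  have hx : ∀ j, Env.y P i * Env.proj P (FreePoly.incl k deg (Poly.x k deg j)) =
      Env.proj P (FreePoly.incl k deg (Poly.sigma i (Poly.x k deg j))) * Env.y P i +
        Env.proj P (FreePoly.incl k deg (P.bracket (Poly.x k deg i) (Poly.x k deg j))) := by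
    intro j
    have h := RingQuot.mkAlgHom_rel k (EnvRel.yx (P := P) i j)
    simp only [map_add, map_mul, map_smul] at h
    rw [Poly.sigma_of_mem i (Poly.x_mem k deg j), map_smul, map_smul, smul_mul_assoc]
    exact h
  induction a using Poly.induction_mul with
  | one =>
    have := P.bracket_x_mul i 1 1
    have h : P.bracket (Poly.x k deg i) 1 = 0 := by simpa using this
    simp [h]
  | add a b h h' => simp only [map_add, mul_add, add_mul, h, h']; abel
  | smul t a h => simp only [map_smul, mul_smul_comm, smul_mul_assoc, h, smul_add]
  | x_mul j p a _ h =>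
    rw [P.bracket_x_mul, map_mul, map_mul, ← mul_assoc, hx, add_mul, mul_assoc, h]
    simp only [map_add, map_mul, mul_add, mul_assoc]
    abel

theorem Env.adjoin_eq_top :
    Algebra.adjoin k (Set.range ((Env.proj P).comp (FreePoly.incl k deg)) ∪
      Set.range (Env.y P)) = ⊤ := by
  let q : FreeAlgebra k (Fin n ⊕ Fin n) →ₐ[k] Env P :=
    (Env.proj P).comp (RingQuot.mkAlgHom k (FreeRel k deg))
  have hq : Function.Surjective q :=
    (RingQuot.mkAlgHom_surjective k (EnvRel P)).comp
      (RingQuot.mkAlgHom_surjective k (FreeRel k deg))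
  rw [← top_le_iff, ← (AlgHom.range_eq_top q).2 hq, ← Algebra.map_top,
    ← FreeAlgebra.adjoin_range_ι, AlgHom.map_adjoin]
  apply Algebra.adjoin_mono
  rintro _ ⟨_, ⟨i | i, rfl⟩, rfl⟩
  · refine Or.inl ⟨Poly.x k deg i, ?_⟩
    rw [AlgHom.comp_apply, FreePoly.incl_x]
    rfl
  · exact Or.inr ⟨i, rfl⟩

/-- The universal property of `F(R)`. -/
noncomputable def FreePoly.lift {B : Type*} [Ring B] [Algebra k B] (φ : Poly k deg →ₐ[k] B)
    (y : Fin n → B) : FreePoly k deg →ₐ[k] B :=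
  RingQuot.liftAlgHom k ⟨FreeAlgebra.lift k (Sum.elim (fun i => φ (Poly.x k deg i)) y), by
    rintro _ _ ⟨i, j⟩
    simp only [map_mul, map_smul, FreeAlgebra.lift_ι_apply, Sum.elim_inl]
    rw [← map_mul, Poly.x_comm, map_smul, map_mul]⟩

theorem FreePoly.lift_y {B : Type*} [Ring B] [Algebra k B] (φ : Poly k deg →ₐ[k] B)
    (y : Fin n → B) (i : Fin n) : FreePoly.lift φ y (FreePoly.y k deg i) = y i := by
  refine (RingQuot.liftAlgHom_mkAlgHom_apply k _ _ _).trans ?_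
  simp

theorem FreePoly.lift_incl {B : Type*} [Ring B] [Algebra k B] (φ : Poly k deg →ₐ[k] B)
    (y : Fin n → B) (a : Poly k deg) :
    FreePoly.lift φ y (FreePoly.incl k deg a) = φ a := by
  have h : (FreePoly.lift φ y).comp (FreePoly.incl k deg) = φ := Poly.hom_ext k deg fun i => by
    rw [AlgHom.comp_apply, FreePoly.incl_x]
    refine (RingQuot.liftAlgHom_mkAlgHom_apply k _ _ _).trans ?_
    simp
  exact DFunLike.congr_fun h a

variable (P)
variable (h2 : (2 : k) = 0 → ∀ i, P.bracket (Poly.x k deg i) (Poly.x k deg i) = 0)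
  (h3 : (3 : k) = 0 → ∀ i, Odd (deg i) →
    P.bracket (Poly.x k deg i) (P.bracket (Poly.x k deg i) (Poly.x k deg i)) = 0)

/-- The action of `R^e` on the free `R`-module on the admissible words. -/
noncomputable def envAction : Env P →ₐ[k] Module.End k (P.envData h2 h3).Mod :=
  RingQuot.liftAlgHom k ⟨FreePoly.lift (Algebra.lsmul k k _) (P.envData h2 h3).Y, by
    rintro _ _ (⟨i, j⟩ | ⟨i, j⟩)
    · apply LinearMap.ext
      intro m
      simp only [FreePoly.psi, map_add, map_mul, map_smul, map_sum, FreePoly.lift_y,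
        FreePoly.lift_incl, LinearMap.add_apply, LinearMap.sum_apply, LinearMap.smul_apply,
        Module.End.mul_apply]
      exact SkewData.commAt (D := P.envData h2 h3) i j m
    · apply LinearMap.ext
      intro m
      simp only [map_add, map_mul, map_smul, FreePoly.lift_y,
        FreePoly.lift_incl, LinearMap.add_apply, LinearMap.smul_apply,
        Module.End.mul_apply, Algebra.lsmul_coe]
      rw [(P.envData h2 h3).Y_smul]
      congr 1
      rw [← smul_assoc]
      congr 1
      exact Poly.sigma_of_mem i (Poly.x_mem k deg j)⟩

theorem envAction_proj (f : FreePoly k deg) :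
    envAction P h2 h3 (Env.proj P f) =
      FreePoly.lift (Algebra.lsmul k k _) (P.envData h2 h3).Y f :=
  RingQuot.liftAlgHom_mkAlgHom_apply k _ _ _

/-- `R^e` is free over `R` on the ordered monomials in the `y_i`. -/
noncomputable def envEquiv : (P.envData h2 h3).Mod ≃ₗ[k] Env P :=
  (P.envData h2 h3).evalEquiv (φ := (Env.proj P).comp (FreePoly.incl k deg)) (y := Env.y P)
    Env.yx Env.yy Env.adjoin_eq_top (envAction P h2 h3)
    (fun a m => by
      rw [AlgHom.comp_apply, envAction_proj, FreePoly.lift_incl, Algebra.lsmul_coe])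
    (fun i => by rw [Env.y, envAction_proj, FreePoly.lift_y])

/-- Exponent vectors as pairs of admissible words. -/
noncomputable def pbwEquiv :
    PBWExponent k deg ≃ (_ : (P.envData h2 h3).Adm) × (polyData k deg).Adm where
  -- The word in `y` comes first: it indexes the coordinate in the `R`-module, while the word in `x`
  -- indexes the basis of each coordinate, as in `Finsupp.basis`.
  toFun e := ⟨(P.envData h2 h3).expEquiv
      ⟨e.1.2, fun r hr => (e.2 r ((sign_self_ne_one_iff _).1 hr).1
        ((sign_self_ne_one_iff _).1 hr).2).2⟩,
    (polyData k deg).expEquiv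
      ⟨e.1.1, fun r hr => (e.2 r ((sign_self_ne_one_iff _).1 hr).1
        ((sign_self_ne_one_iff _).1 hr).2).1⟩⟩
  invFun K := ⟨(((polyData k deg).expEquiv.symm K.2).1, ((P.envData h2 h3).expEquiv.symm K.1).1),
    fun r hr h => ⟨((polyData k deg).expEquiv.symm K.2).2 r ((sign_self_ne_one_iff _).2 ⟨hr, h⟩),
      ((P.envData h2 h3).expEquiv.symm K.1).2 r ((sign_self_ne_one_iff _).2 ⟨hr, h⟩)⟩⟩
  left_inv e := by simp; rfl
  right_inv K := by simp

/-- The PBW basis of `R^e`. -/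
noncomputable def pbwBasis : Module.Basis (PBWExponent k deg) k (Env P) :=
  ((Finsupp.basis fun _ : (P.envData h2 h3).Adm => polyBasis k deg).map
    (envEquiv P h2 h3)).reindex (pbwEquiv P h2 h3).symm

theorem pbwBasis_apply (e : PBWExponent k deg) :
    pbwBasis P h2 h3 e = Env.monomial P e.1.1 e.1.2 := by
  rw [pbwBasis, Module.Basis.reindex_apply, Module.Basis.map_apply, Finsupp.coe_basis]
  refine (SkewData.eval_single _ _ _ _ _).trans ?_
  rw [polyBasis_apply]
  change ((Env.proj P).comp (FreePoly.incl k deg))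
      ((SkewData.sortedWord e.1.1).map (Poly.x k deg)).prod *
    ((SkewData.sortedWord e.1.2).map (Env.y P)).prod = _
  rw [map_list_prod, List.map_map, SkewData.prod_map_sortedWord, SkewData.prod_map_sortedWord]
  rfl

end Env

end DGP

theorem mainTheorem2 {k : Type*} [Field k] {n : ℕ} (deg : Fin n → ℤ)
    (P : DGP.DGPoisson (DGP.Poly.comp k deg))
    (h2 : (2 : k) = 0 → ∀ i, P.bracket (DGP.Poly.x k deg i) (DGP.Poly.x k deg i) = 0)
    (h3 : (3 : k) = 0 → ∀ i, Odd (deg i) →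
      P.bracket (DGP.Poly.x k deg i)
        (P.bracket (DGP.Poly.x k deg i) (DGP.Poly.x k deg i)) = 0) :
    ∃ b : Module.Basis (DGP.PBWExponent k deg) k (DGP.Env P),
      ∀ e : DGP.PBWExponent k deg, b e = DGP.Env.monomial P e.1.1 e.1.2 :=
  ⟨DGP.pbwBasis P h2 h3, DGP.pbwBasis_apply P h2 h3⟩
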